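/- **Data and model.** Let $Z=(L_1,A_1,\dots,L_\tau,A_\tau,Y)$, where the covariates $L_t$ take values in Polish spaces, the exposures $A_t$ in countable discrete sets $\mathcal A_t$, and $Y$ is real. Write $\bar X_t=(X_1,\dots,X_t)$ and $H_t=(\bar A_{t-1},\bar L_t)$. Let $\nu$ be a measure on the range of $Z$. The nonparametric model $\mathcal M$ is the set of all probability measures with a continuous density with respect to $\nu$. Let $P\in\mathcal M$ be the law of $Z$, and let $g_t(a_t\mid h_t)=P(A_t=a_t\mid H_t=h_t)$. Let $d=(d_1,\dots,d_\tau)$ be a fixed policy (not depending on $P$), consisting of measurable functions $d_t(\bar s_t,h_t)\in\mathcal A_t$ of a natural treatment history $\bar s_t$ and a history $h_t$. **Parameter.** Put $q_{\tau+1}=Y$ and, recursively for $t=\tau,\dots,1$, $$m_t(\bar s_t,a_t,h_t)=E\big[q_{t+1}(\bar s_t,A_{t+1},H_{t+1})\mid A_t=a_t,H_t=h_t\big],$$ $$q_t(\bar s_{t-1},a_t,h_t)=m_t\big((\bar s_{t-1},a_t),\,d_t((\bar s_{t-1},a_t),h_t),\,h_t\big),$$ and let $\theta=\Theta(P)=E[q_1(A_1,H_1)]$.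 For $k=1,\dots,\tau$ let $D_{0,k}(\bar s_k)=\mathbf 1\{A_1=d_1(\bar s_1,H_1),\dots,A_k=d_k(\bar s_k,H_k)\}$ and $$\varphi_1(Z)=\sum_{k=1}^{\tau}\sum_{\bar s_k}D_{0,k}(\bar s_k)\Big(\prod_{u=1}^k\frac{g_u(s_u\mid H_u)}{g_u(A_u\mid H_u)}\Big)\big\{q_{k+1}(\bar s_k,A_{k+1},H_{k+1})-m_k(\bar s_k,A_k,H_k)\big\}+q_1(A_1,H_1).$$ **Assumptions.** (i) Positivity: for each $t$, for almost every $H_t$ and every $\bar s_t$ with $A_u=d_u(\bar s_u,H_u)$ for all $u<t$ and $g_u(s_u\mid H_u)>0$ for all $u\le t$, one has $g_t(d_t(\bar s_t,H_t)\mid H_t)>0$. (ii) $E\big[\sum_{\bar s_\tau}D_{0,\tau}(\bar s_\tau)\prod_{u=1}^{\tau}\frac{g_u(s_u\mid H_u)}{g_u(A_u\mid H_u)}\,|Y|\big]<\infty$, i.e. $Y$ is integrable under the identified post-intervention law. (iii) $\varphi_1(Z)$ has a finite second moment under $P$. **Smooth submodels.** A smooth submodel through $P$ with score $s$ is a family of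 probability measures $P_\varepsilon$ (real $\varepsilon$) with $P_0=P$ which, for $\varepsilon$ near $0$, lie in $\mathcal M$ with continuous densities $p_\varepsilon$ with respect to $\nu$, such that $s(z)=\frac{d}{d\varepsilon}\log p_\varepsilon(z)\big|_{\varepsilon=0}$ exists for $P$-almost every $z$, and, for some constant $C$ and all $\varepsilon$ near $0$, $|p_\varepsilon-p_0|\le C|\varepsilon|\,p_0$ holds $\nu$-almost everywhere. The tangent space at $P$ is the $L^2(P)$-closure of the linear span of the scores of all such submodels. **Claim.** The efficient influence function of $\theta$ in the nonparametric model is $\bar\varphi_1(Z)=\varphi_1(Z)-\theta$. That is: $\bar\varphi_1\in L^2(P)$; for every smooth submodel $(P_\varepsilon)$ through $P$ with score $s$, the function $\varepsilon\mapsto\Theta(P_\varepsilon)$ is differentiable at $0$ with $$\frac{d}{d\varepsilon}\Theta(P_\varepsilon)\Big|_{\varepsilon=0}=E[\bar\varphi_1(Z)\,s(Z)];$$ and $\bar\varphi_1$ belongs to the tangent space at $P$. -/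

import Mathlib

open MeasureTheory ProbabilityTheory Filter Topology
open scoped NNReal ENNReal

noncomputable section

/-! ## The nonparametric model, smooth submodels, tangent space, efficient influence function -/

section Semiparametric

variable {Z : Type*} [TopologicalSpace Z] [MeasurableSpace Z]

/-- The nonparametric model: all probability measures with a continuous density with respect to
the dominating measure `ν`. -/
def nonparametricModel (ν : Measure Z) : Set (ProbabilityMeasure Z) :=
  {P | ∃ p : Z → ℝ≥0, Continuous p ∧ (P : Measure Z) = ν.withDensity (fun z => (p z : ℝ≥0∞))}

/-- `ε ↦ Q ε` is a smooth one-dimensional submodel of the nonparametric model through `P`, with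
score `s`: near `ε = 0` it consists of elements of the model, with continuous densities `p ε`;
the score is the derivative of the log-density at `ε = 0`; and the relative perturbation of the
density is, uniformly in `z`, of order `ε`. -/
def IsSmoothSubmodel (ν : Measure Z) (P : ProbabilityMeasure Z)
    (Q : ℝ → ProbabilityMeasure Z) (s : Z → ℝ) : Prop :=
  ∃ p : ℝ → Z → ℝ≥0,
    Q 0 = P ∧
    (∀ᶠ ε in 𝓝 (0 : ℝ), Continuous (p ε) ∧
      (Q ε : Measure Z) = ν.withDensity (fun z => (p ε z : ℝ≥0∞))) ∧
    (∀ᵐ z ∂(P : Measure Z), HasDerivAt (fun ε : ℝ => Real.log (p ε z : ℝ)) (s z) 0) ∧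
    ∃ C : ℝ, ∀ᶠ ε in 𝓝 (0 : ℝ), ∀ᵐ z ∂ν,
      |(p ε z : ℝ) - (p 0 z : ℝ)| ≤ C * |ε| * (p 0 z : ℝ)

/-- The tangent space at `P`: the `L²(P)`-closure of the linear span of all scores. -/
def tangentSpace (ν : Measure Z) (P : ProbabilityMeasure Z) :
    Submodule ℝ (Lp ℝ 2 (P : Measure Z)) :=
  (Submodule.span ℝ {x : Lp ℝ 2 (P : Measure Z) |
    ∃ (Q : ℝ → ProbabilityMeasure Z) (s : Z → ℝ),
      IsSmoothSubmodel ν P Q s ∧ x =ᵐ[(P : Measure Z)] s}).topologicalClosure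

/-- `φ` is the efficient influence function (canonical gradient) at `P` of the parameter `Θ` in
the nonparametric model: a square-integrable element of the tangent space that represents the
derivative of `Θ` along every smooth submodel through `P`. -/
structure IsEfficientInfluenceFunction (ν : Measure Z) (Θ : ProbabilityMeasure Z → ℝ)
    (P : ProbabilityMeasure Z) (φ : Z → ℝ) : Prop where
  memLp : MemLp φ 2 (P : Measure Z)
  hasDerivAt : ∀ (Q : ℝ → ProbabilityMeasure Z) (s : Z → ℝ), IsSmoothSubmodel ν P Q s →
    HasDerivAt (fun ε : ℝ => Θ (Q ε)) (∫ z, φ z * s z ∂(P : Measure Z)) 0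
  mem_tangentSpace : memLp.toLp φ ∈ tangentSpace ν P

end Semiparametric

/-! ## Longitudinal data

The time points `1, …, τ` are numbered `0, …, τ - 1`. -/

/-- Sequences of length `k` with `u`-th entry in `X u`. -/
abbrev Traj (X : ℕ → Type*) (k : ℕ) : Type _ := ∀ u : Fin k, X u

/-- Values of `(L_1, A_1, …, L_k, A_k)`, that is, of `(A_k, H_k)`. -/
abbrev Past (L A : ℕ → Type*) (k : ℕ) : Type _ := Traj L k × Traj A k

/-- Values of `H_{k+1}`, i.e. of `(L_1, A_1, …, L_k, A_k, L_{k+1})`. -/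
abbrev Hist (L A : ℕ → Type*) (k : ℕ) : Type _ := Traj L (k + 1) × Traj A k

/-- Values of `Z = (L_1, A_1, …, L_τ, A_τ, Y)`, stored as (covariates, treatments, outcome). -/
abbrev LongData (L A : ℕ → Type*) (τ : ℕ) : Type _ := Traj L τ × Traj A τ × ℝ

/-- A policy: at time index `t`, the intervened treatment is a function of the natural treatment
values up to time `t` (time `t` included) and of the history. -/
abbrev Policy (L A : ℕ → Type*) : Type _ := ∀ t : ℕ, Traj A (t + 1) → Hist L A t → A t

/-- The first `k` entries of a sequence. -/
def Traj.take {X : ℕ → Type*} {k n : ℕ} (h : k ≤ n) (x : Traj X n) : Traj X k :=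
  fun u => x (Fin.castLE h u)

/-- Append one entry at the end of a sequence. -/
def Traj.snoc {X : ℕ → Type*} {k : ℕ} (x : Traj X k) (a : X k) : Traj X (k + 1) :=
  Fin.snoc (α := fun i : Fin (k + 1) => X i) x a

section Longitudinal

variable {L A : ℕ → Type*} {τ : ℕ}

/-- `(L_1, A_1, …, L_k, A_k)` as a function of `Z`. -/
def pastOf {k : ℕ} (h : k ≤ τ) (z : LongData L A τ) : Past L A k :=
  (Traj.take h z.1, Traj.take h z.2.1)

/-- The history just before the treatment at time index `t`, as a function of `Z`. -/
def histOf {t : ℕ} (h : t < τ) (z : LongData L A τ) : Hist L A t :=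
  (Traj.take (Nat.succ_le_of_lt h) z.1, Traj.take h.le z.2.1)

/-- The treatment at time index `t`, as a function of `Z`. -/
def trtOf {t : ℕ} (h : t < τ) (z : LongData L A τ) : A t := z.2.1 ⟨t, h⟩

/-- The outcome `Y`, as a function of `Z`. -/
def outcome (z : LongData L A τ) : ℝ := z.2.2

open scoped Classical in
/-- `D_{0,k}(s̄_k) = 1{A_1 = d_1(s̄_1, H_1), …, A_k = d_k(s̄_k, H_k)}`. -/
def regimeIndicator (d : Policy L A) {k : ℕ} (hk : k ≤ τ) (s : Traj A k)
    (z : LongData L A τ) : ℝ :=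
  if ∀ u : Fin k, trtOf (u.isLt.trans_le hk) z =
      d u (Traj.take (Nat.succ_le_of_lt u.isLt) s) (histOf (u.isLt.trans_le hk) z)
  then 1 else 0

variable [∀ t, MeasurableSpace (L t)] [∀ t, StandardBorelSpace (L t)] [∀ t, Nonempty (L t)]
  [∀ t, MeasurableSpace (A t)] [∀ t, DiscreteMeasurableSpace (A t)] [∀ t, Countable (A t)]
  [∀ t, Nonempty (A t)]

/-- The treatment mechanism: the conditional probability mass function, at `a`, of the treatment at
time index `t`, given that the history equals `h`. -/
def treatProb (P : ProbabilityMeasure (LongData L A τ)) {t : ℕ} (ht : t < τ) (a : A t)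
    (h : Hist L A t) : ℝ :=
  (condDistrib (trtOf (L := L) ht) (histOf (L := L) (A := A) ht) (P : Measure (LongData L A τ)) h).real
    {a}

/-- Backward recursion for `q_{k+1}(s̄_k, A_{k+1}, H_{k+1})`, where `j = τ - k` is the number of
remaining time points and `q_{τ+1} = Y`. -/
def qAux (d : Policy L A) (P : ProbabilityMeasure (LongData L A τ)) :
    (j k : ℕ) → k + j = τ → Traj A k → LongData L A τ → ℝ
  | 0, _, _, _, z => outcome z
  | j + 1, k, hk, s, z =>
    let s' : Traj A (k + 1) := Traj.snoc s (trtOf (by omega : k < τ) z)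
    let h : Hist L A k := histOf (by omega : k < τ) z
    ∫ z', qAux d P j (k + 1) (by omega) s' z'
      ∂(condDistrib (fun z => z) (pastOf (by omega : k + 1 ≤ τ))
        (P : Measure (LongData L A τ)) (h.1, Traj.snoc h.2 (d k s' h)))

/-- `q_{k+1}(s̄_k, A_{k+1}, H_{k+1})` as a function of `s̄_k` and `Z`; for `k = τ` this is `Y`. -/
def qReg (d : Policy L A) (P : ProbabilityMeasure (LongData L A τ)) {k : ℕ} (hk : k ≤ τ)
    (s : Traj A k) (z : LongData L A τ) : ℝ :=
  qAux d P (τ - k) k (by omega) s z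

/-- The regression function
`m_k(s̄_k, a_k, h_k) = E[q_{k+1}(s̄_k, A_{k+1}, H_{k+1}) ∣ A_k = a_k, H_k = h_k]`. -/
def mReg (d : Policy L A) (P : ProbabilityMeasure (LongData L A τ)) {k : ℕ} (hk : k ≤ τ)
    (s : Traj A k) (x : Past L A k) : ℝ :=
  ∫ z, qReg d P hk s z
    ∂(condDistrib (fun z => z) (pastOf hk) (P : Measure (LongData L A τ)) x)

theorem qReg_eq_qAux (d : Policy L A) (P : ProbabilityMeasure (LongData L A τ)) {j k : ℕ}
    (hk : k ≤ τ) (h : k + j = τ) (s : Traj A k) (z : LongData L A τ) :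
    qReg d P hk s z = qAux d P j k h s z := by
  obtain rfl : j = τ - k := by omega
  rfl

/-- `q_{τ+1} = Y`. -/
theorem qReg_self (d : Policy L A) (P : ProbabilityMeasure (LongData L A τ))
    (s : Traj A τ) (z : LongData L A τ) : qReg d P le_rfl s z = outcome z := by
  rw [qReg_eq_qAux d P le_rfl (j := 0) (by omega)]
  simp only [qAux]

/-- `q_k(s̄_{k-1}, a_k, h_k) = m_k((s̄_{k-1}, a_k), d_k((s̄_{k-1}, a_k), h_k), h_k)`. -/
theorem qReg_of_lt (d : Policy L A) (P : ProbabilityMeasure (LongData L A τ)) {k : ℕ}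
    (hk : k < τ) (s : Traj A k) (z : LongData L A τ) :
    qReg d P hk.le s z =
      mReg d P (Nat.succ_le_of_lt hk) (Traj.snoc s (trtOf hk z))
        ((histOf hk z).1,
          Traj.snoc (histOf hk z).2 (d k (Traj.snoc s (trtOf hk z)) (histOf hk z))) := by
  rw [qReg_eq_qAux d P hk.le (j := τ - (k + 1) + 1) (by omega)]
  simp only [qAux, mReg]
  rfl

/-- The parameter `θ = E[q_1(A_1, H_1)]`, as a functional of the distribution. -/
def theta (d : Policy L A) (P : ProbabilityMeasure (LongData L A τ)) : ℝ :=
  ∫ z, qReg d P (Nat.zero_le τ) (fun u => u.elim0) z ∂(P : Measure (LongData L A τ))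

/-- `∏_{u ≤ k} g_u(s_u ∣ H_u) / g_u(A_u ∣ H_u)`. -/
def ratioProd (P : ProbabilityMeasure (LongData L A τ)) {k : ℕ} (hk : k ≤ τ) (s : Traj A k)
    (z : LongData L A τ) : ℝ :=
  ∏ u : Fin k,
    treatProb P (u.isLt.trans_le hk) (s u) (histOf (u.isLt.trans_le hk) z) /
      treatProb P (u.isLt.trans_le hk) (trtOf (u.isLt.trans_le hk) z)
        (histOf (u.isLt.trans_le hk) z)

/-- The function `φ_1(Z)`: the sum over `k = 1, …, τ` and over `s̄_k` of
`D_{0,k}(s̄_k) (∏_{u ≤ k} g_u(s_u ∣ H_u) / g_u(A_u ∣ H_u))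
  {q_{k+1}(s̄_k, A_{k+1}, H_{k+1}) - m_k(s̄_k, A_k, H_k)}`, plus `q_1(A_1, H_1)`. -/
def phiOne (d : Policy L A) (P : ProbabilityMeasure (LongData L A τ))
    (z : LongData L A τ) : ℝ :=
  (∑ k : Fin τ, ∑' s : Traj A (k + 1),
    regimeIndicator d (Nat.succ_le_of_lt k.isLt) s z *
      ratioProd P (Nat.succ_le_of_lt k.isLt) s z *
      (qReg d P (Nat.succ_le_of_lt k.isLt) s z -
        mReg d P (Nat.succ_le_of_lt k.isLt) s (pastOf (Nat.succ_le_of_lt k.isLt) z)))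
  + qReg d P (Nat.zero_le τ) (fun u => u.elim0) z

/-- Positivity: at every time, along every natural treatment path that has positive conditional
probability and whose intervened treatments are the ones recorded in the history, the intervened
treatment has positive conditional probability as well. -/
def Positivity (d : Policy L A) (P : ProbabilityMeasure (LongData L A τ)) : Prop :=
  ∀ (t : ℕ) (ht : t < τ), ∀ᵐ z ∂(P : Measure (LongData L A τ)), ∀ s : Traj A (t + 1),
    regimeIndicator d ht.le (Traj.take (Nat.le_succ t) s) z = 1 →
    (∀ u : Fin (t + 1), 0 < treatProb P (lt_of_lt_of_le u.isLt (Nat.succ_le_of_lt ht)) (s u)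
      (histOf (lt_of_lt_of_le u.isLt (Nat.succ_le_of_lt ht)) z)) →
    0 < treatProb P ht (d t s (histOf ht z)) (histOf ht z)

/-- The outcome has a finite first absolute moment under the identified post-intervention
distribution. -/
def FiniteInterventionMean (d : Policy L A) (P : ProbabilityMeasure (LongData L A τ)) : Prop :=
  ∫⁻ z, ∑' s : Traj A τ, ENNReal.ofReal
    (regimeIndicator d le_rfl s z * ratioProd P le_rfl s z * |outcome z|)
      ∂(P : Measure (LongData L A τ)) < ∞

end Longitudinal

end

/-! Write `W_k(s̄_k, Z)` for `D_{0,k}` times the product of ratios. All integrals are taken over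
pairs (natural history, data point) against counting measure times a law, so that the sums over
`s̄_k` become part of one integral. For a law `Q`, two facts carry the argument.

Change of variables (`map_weightMeasure_succ`): under `W_{k+1} dQ` the pair (natural history, past)
has the distribution that `W_k dQ` gives after recording the natural treatment and replacing it by
the intervened one. Hence `∫ m_{k+1} W_{k+1} dQ = ∫ q_{k+1} W_k dQ`. The functions may be the
regressions of a different law `P`.

Orthogonality (`integrable_and_integral_weight_mul_mReg`): `W_k` depends on the past only, so the
residual `q_{k+1} - m_k` of `P` has integral zero under `W_k dP`, even with the weights of `Q`.

The first fact, applied with the regressions of `P`, telescopes to `Θ(Q) = ∑_k ∫ W_k^Q (q_{k+1} -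
m_k) dQ + ∫ q_1 dQ`, in which no regression of `Q` occurs. If `r = dQ/dP`, orthogonality turns `dQ`
into `(r - 1) dP` in each summand. Subtracting `∫ (r - 1) φ_1 dP` leaves `∑_k ∫ (r - 1)(W_k^Q -
W_k^P)(q_{k+1} - m_k) dP`. If `|r - 1| ≤ c < 1`, the treatment mechanisms differ by a factor of at
most `l = (1 + c)/(1 - c)`, so `|W_k^Q - W_k^P| ≤ (l^(2τ) - 1) W_k^P`, and the remainder is `o(c)`
(`exists_abs_theta_sub_le`). On a smooth submodel `c = O(|ε|)`, and dominated convergence gives the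
derivative.

Finally, the tangent space contains every mean-zero element of `L²(P)`: each centred bounded
continuous `h` is the score of the path `p (1 + ε h)`, and such `h` are dense among mean-zero
functions. The gradient has mean zero by orthogonality. -/

noncomputable section

set_option linter.unusedSectionVars false

/-! ### Conditional distributions in the presence of a countable parameter -/

section Conditioning

variable {Ω β S : Type*} [MeasurableSpace Ω] [StandardBorelSpace Ω] [Nonempty Ω]
  [MeasurableSpace β] [MeasurableSpace S] [Countable S] [MeasurableSingletonClass S]

/-- Disintegration on each slice of fixed `s`; the conditional kernel does not depend on the slice.
-/
theorem map_count_prod_eq_compProd (μ : Measure Ω) [IsProbabilityMeasure μ] {X : Ω → β}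
    (hX : Measurable X) :
    ((Measure.count : Measure S).prod μ).map (fun y => ((y.1, X y.2), y.2)) =
      ((Measure.count : Measure S).prod (μ.map X)) ⊗ₘ
        (Kernel.prodMkLeft S (condDistrib (fun z => z) X μ)) := by
  have : IsProbabilityMeasure (μ.map X) := Measure.isProbabilityMeasure_map hX.aemeasurable
  refine Measure.ext_of_lintegral _ fun f hf => ?_
  rw [lintegral_map hf (by fun_prop), Measure.lintegral_compProd hf,
    lintegral_prod _ (by fun_prop),
    lintegral_prod _ (Measurable.lintegral_kernel_prod_right' hf).aemeasurable]
  refine lintegral_congr fun s => ?_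
  simp only [Kernel.prodMkLeft_apply]
  have h := compProd_map_condDistrib (mβ := inferInstance) (X := X) (μ := μ) (Y := fun z : Ω => z)
    measurable_id.aemeasurable
  have h2 := Measure.lintegral_compProd (μ := μ.map X) (κ := condDistrib (fun z => z) X μ)
    (f := fun q => f ((s, q.1), q.2)) (by fun_prop)
  rw [← h2, h, lintegral_map (by fun_prop) (by fun_prop)]

/-- The tower property with the factor `w`, a function of `(s, X)`, taken out. Only the product `w *
F` has to be integrable; this matters because the weights are unbounded and `F` alone may fail to be
integrable. -/
theorem integrable_and_integral_condDistrib_of_count_prod (μ : Measure Ω) [IsProbabilityMeasure μ]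
    {X : Ω → β} (hX : Measurable X) {w : S × β → ℝ} (hw : Measurable w) {F : S → Ω → ℝ}
    (hF : Measurable F.uncurry)
    (hint : Integrable (fun y : S × Ω => w (y.1, X y.2) * F y.1 y.2) (Measure.count.prod μ)) :
    Integrable (fun y : S × Ω => w (y.1, X y.2) *
        ∫ z, F y.1 z ∂(condDistrib (fun z => z) X μ (X y.2))) (Measure.count.prod μ) ∧
      ∫ y : S × Ω, w (y.1, X y.2) * ∫ z, F y.1 z ∂(condDistrib (fun z => z) X μ (X y.2))
          ∂(Measure.count.prod μ) =
        ∫ y : S × Ω, w (y.1, X y.2) * F y.1 y.2 ∂(Measure.count.prod μ) := by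
  have : IsProbabilityMeasure (μ.map X) := Measure.isProbabilityMeasure_map hX.aemeasurable
  set κ := condDistrib (fun z => z) X μ
  let G : (S × β) × Ω → ℝ := fun q => w q.1 * F q.1.1 q.2
  have hGm : Measurable G :=
    (hw.comp measurable_fst).mul
      (hF.comp ((measurable_fst.comp measurable_fst).prodMk measurable_snd))
  have hφ : Measurable (fun y : S × Ω => ((y.1, X y.2), y.2)) := by fun_prop
  have hψ : Measurable (fun y : S × Ω => (y.1, X y.2)) := by fun_prop
  have hG : Integrable G (((Measure.count : Measure S).prod (μ.map X)) ⊗ₘ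
      (Kernel.prodMkLeft S κ)) := by
    rw [← map_count_prod_eq_compProd μ hX,
      integrable_map_measure hGm.aestronglyMeasurable hφ.aemeasurable]
    exact hint
  have hmap : ((Measure.count : Measure S).prod μ).map (fun y => (y.1, X y.2)) =
      (Measure.count : Measure S).prod (μ.map X) := by
    have := Measure.map_prod_map (f := id) (Measure.count : Measure S) μ measurable_id hX
    rw [Measure.map_id] at this
    exact this.symm
  have h1 : Integrable (fun x => ∫ y, G (x, y) ∂(Kernel.prodMkLeft S κ x))
      ((Measure.count : Measure S).prod (μ.map X)) := by
    rw [Measure.compProd] at hG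
    simpa using hG.integral_compProd
  have h2 := Measure.integral_compProd hG
  simp only [G, integral_const_mul, Kernel.prodMkLeft_apply] at h1 h2
  have h1m := h1.aestronglyMeasurable
  rw [← hmap] at h1 h1m
  rw [integrable_map_measure h1m hψ.aemeasurable] at h1
  refine ⟨h1, ?_⟩
  rw [← map_count_prod_eq_compProd μ hX, integral_map hφ.aemeasurable hGm.aestronglyMeasurable,
    ← hmap, integral_map hψ.aemeasurable h1m] at h2
  exact h2.symm

/-- Fubini; it converts between the product integrals used in the proof and the series over `s̄_k`
in `phiOne`. -/
theorem integrable_tsum_of_count_prod {E : Type*} [MeasurableSpace E] (μ : Measure E)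
    [IsFiniteMeasure μ] {F : S → E → ℝ}
    (hF : Integrable F.uncurry ((Measure.count : Measure S).prod μ)) :
    Integrable (fun z => ∑' s, F s z) μ ∧
      ∫ z, ∑' s, F s z ∂μ = ∫ y, F.uncurry y ∂((Measure.count : Measure S).prod μ) := by
  have h : (fun z => ∫ s, F s z ∂(Measure.count : Measure S)) =ᵐ[μ] fun z => ∑' s, F s z := by
    filter_upwards [hF.prod_left_ae] with z hz
    have h := integral_countable hz
    simpa [Measure.real] using h
  refine ⟨(hF.integral_prod_right).congr h, ?_⟩
  rw [← integral_congr_ae h, integral_prod_symm _ hF]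
  rfl

theorem lintegral_eq_lintegral_tsum_condDistrib {E : Type*} [MeasurableSpace E]
    [StandardBorelSpace S] [Nonempty S] (μ : Measure E)
    [IsFiniteMeasure μ] {X : E → β} (hX : Measurable X) {T : E → S} (hT : Measurable T)
    {G : β → S → ℝ≥0∞} (hG : ∀ a, Measurable fun h => G h a) :
    ∫⁻ z, G (X z) (T z) ∂μ = ∫⁻ z, ∑' a, condDistrib T X μ (X z) {a} * G (X z) a ∂μ := by
  have hG' : Measurable (fun q : β × S => G q.1 q.2) := measurable_from_prod_countable_left hG
  have h := compProd_map_condDistrib (mβ := inferInstance) (X := X) (μ := μ) (Y := T) hT.aemeasurable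
  have h1 : ∫⁻ z, G (X z) (T z) ∂μ = ∫⁻ q, G q.1 q.2 ∂(μ.map fun a => (X a, T a)) := by
    rw [lintegral_map hG' (by fun_prop)]
  rw [h1, ← h, Measure.lintegral_compProd hG']
  have h3 : ∀ b, ∫⁻ a, G b a ∂(condDistrib T X μ b) = ∑' a, condDistrib T X μ b {a} * G b a := by
    intro b
    rw [lintegral_countable']
    simp_rw [mul_comm]
  simp_rw [h3]
  rw [lintegral_map _ hX]
  exact Measurable.tsum fun a =>
    ((condDistrib T X μ).measurable_coe (measurableSet_singleton a)).mul (hG a)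

/-- Integrated over `{X ∈ s}`, the left side is `μ'(X ∈ s, T = a) ≤ b μ(X ∈ s, T = a)`, which is `b`
times the `μ`-integral of the conditional probability under `μ`. Passing from `μ` back to `μ'` costs
the factor `b'`. -/
theorem condDistrib_singleton_le_of_le_smul {E : Type*} [MeasurableSpace E]
    [StandardBorelSpace S] [Nonempty S] {μ μ' : Measure E}
    [IsFiniteMeasure μ] [IsFiniteMeasure μ'] {X : E → β} (hX : Measurable X) {T : E → S}
    (hT : Measurable T) {b b' : ℝ≥0∞} (hb : μ' ≤ b • μ) (hb' : μ ≤ b' • μ') :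
    ∀ᵐ z ∂μ', ∀ a, condDistrib T X μ' (X z) {a} ≤ b * b' * condDistrib T X μ (X z) {a} := by
  rw [ae_all_iff]
  intro a
  have key : (fun x => condDistrib T X μ' x {a}) ≤ᵐ[μ'.map X]
      fun x => b * b' * condDistrib T X μ x {a} := by
    have hm : Measurable (fun x => condDistrib T X μ x {a}) :=
      (condDistrib T X μ).measurable_coe (measurableSet_singleton a)
    refine ae_le_of_forall_setLIntegral_le_of_sigmaFinite
      ((condDistrib T X μ').measurable_coe (measurableSet_singleton a)) fun s hs _ => ?_
    rw [setLIntegral_map hs ((condDistrib T X μ').measurable_coe (measurableSet_singleton a)) hX,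
      setLIntegral_map hs (hm.const_mul _) hX,
      setLIntegral_preimage_condDistrib hX hT.aemeasurable (measurableSet_singleton a) hs,
      lintegral_const_mul (b * b') (f := fun x => condDistrib T X μ (X x) {a}) (hm.comp hX)]
    calc μ' (X ⁻¹' s ∩ T ⁻¹' {a}) ≤ b * μ (X ⁻¹' s ∩ T ⁻¹' {a}) := by
          simpa using hb (X ⁻¹' s ∩ T ⁻¹' {a})
      _ = b * ∫⁻ z in X ⁻¹' s, condDistrib T X μ (X z) {a} ∂μ := by
          rw [setLIntegral_preimage_condDistrib hX hT.aemeasurable (measurableSet_singleton a) hs]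
      _ ≤ b * ∫⁻ z in X ⁻¹' s, condDistrib T X μ (X z) {a} ∂(b' • μ') := by
          gcongr
      _ = b * b' * ∫⁻ z in X ⁻¹' s, condDistrib T X μ (X z) {a} ∂μ' := by
          rw [Measure.restrict_smul, lintegral_smul_measure, smul_eq_mul, mul_assoc]
  exact ae_of_ae_map hX.aemeasurable key

end Conditioning

/-! ### Sequences, histories and pasts -/

section Structure

variable {L A : ℕ → Type*} {τ : ℕ}

@[simp] theorem Traj.take_snoc {X : ℕ → Type*} {k n : ℕ} (h : n ≤ k) (x : Traj X k) (a : X k) :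
    Traj.take (h.trans (Nat.le_succ k)) (Traj.snoc x a) = Traj.take h x := by
  funext u
  exact Fin.snoc_castSucc (α := fun i : Fin (k + 1) => X i) a x (Fin.castLE h u)

@[simp] theorem Traj.snoc_castSucc {X : ℕ → Type*} {k : ℕ} (x : Traj X k) (a : X k) (u : Fin k) :
    Traj.snoc x a u.castSucc = x u :=
  Fin.snoc_castSucc (α := fun i : Fin (k + 1) => X i) a x u

@[simp] theorem Traj.snoc_last {X : ℕ → Type*} {k : ℕ} (x : Traj X k) (a : X k) :
    Traj.snoc x a (Fin.last k) = a :=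
  Fin.snoc_last (α := fun i : Fin (k + 1) => X i) a x

/-- Sequences of length `k + 1` are pairs of a sequence of length `k` and a last entry. -/
def Traj.snocEquiv (X : ℕ → Type*) (k : ℕ) : Traj X k × X k ≃ Traj X (k + 1) where
  toFun p := Traj.snoc p.1 p.2
  invFun x := (Traj.take (Nat.le_succ k) x, x (Fin.last k))
  left_inv p := by
    refine Prod.ext ?_ (Traj.snoc_last _ _)
    exact Traj.take_snoc le_rfl p.1 p.2
  right_inv x := by
    funext u
    refine Fin.lastCases ?_ (fun u => ?_) u
    · exact Traj.snoc_last _ _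
    · exact Traj.snoc_castSucc _ _ u

theorem pastOf_succ {k : ℕ} (hk : k < τ) (z : LongData L A τ) :
    pastOf (Nat.succ_le_of_lt hk) z = ((histOf hk z).1, Traj.snoc (histOf hk z).2 (trtOf hk z)) :=
  Prod.ext rfl ((Traj.snocEquiv A k).right_inv (Traj.take (Nat.succ_le_of_lt hk) z.2.1)).symm

/-- A data point whose first `k` covariates and treatments are the given ones. -/
def Past.extend [∀ t, Nonempty (L t)] [∀ t, Nonempty (A t)] (τ : ℕ) {k : ℕ} (x : Past L A k) :
    LongData L A τ :=
  (fun u => if h : (u : ℕ) < k then x.1 ⟨u, h⟩ else Classical.arbitrary _,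
    fun u => if h : (u : ℕ) < k then x.2 ⟨u, h⟩ else Classical.arbitrary _, 0)

section Extend

variable [∀ t, Nonempty (L t)] [∀ t, Nonempty (A t)]

theorem histOf_extend_pastOf {k t : ℕ} (hk : k ≤ τ) (ht : t < k) (z : LongData L A τ) :
    histOf (ht.trans_le hk) (Past.extend τ (pastOf hk z)) = histOf (ht.trans_le hk) z := by
  refine Prod.ext (funext fun u => ?_) (funext fun u => ?_)
  · have h : (u : ℕ) < k := by omega
    simp [histOf, Past.extend, pastOf, Traj.take, h]
  · have h : (u : ℕ) < k := by omega
    simp [histOf, Past.extend, pastOf, Traj.take, h]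

theorem trtOf_extend_pastOf {k t : ℕ} (hk : k ≤ τ) (ht : t < k) (z : LongData L A τ) :
    trtOf (ht.trans_le hk) (Past.extend τ (pastOf hk z)) = trtOf (ht.trans_le hk) z := by
  simp [trtOf, Past.extend, pastOf, Traj.take, ht]

end Extend

end Structure

/-! ### The weights and their recursion -/

section Weight

variable {L A : ℕ → Type*} {τ : ℕ}
variable [∀ t, MeasurableSpace (L t)] [∀ t, StandardBorelSpace (L t)] [∀ t, Nonempty (L t)]
  [∀ t, MeasurableSpace (A t)] [∀ t, DiscreteMeasurableSpace (A t)] [∀ t, Countable (A t)]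
  [∀ t, Nonempty (A t)]

/-- The weight `D_{0,k}(s̄_k) ∏_{u ≤ k} g_u(s_u ∣ H_u) / g_u(A_u ∣ H_u)`. -/
def weight (d : Policy L A) (P : ProbabilityMeasure (LongData L A τ)) {k : ℕ} (hk : k ≤ τ)
    (s : Traj A k) (z : LongData L A τ) : ℝ :=
  regimeIndicator d hk s z * ratioProd P hk s z

theorem treatProb_nonneg (P : ProbabilityMeasure (LongData L A τ)) {t : ℕ} (ht : t < τ) (a : A t)
    (h : Hist L A t) : 0 ≤ treatProb P ht a h := measureReal_nonneg

theorem ofReal_treatProb (P : ProbabilityMeasure (LongData L A τ)) {t : ℕ} (ht : t < τ) (a : A t)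
    (h : Hist L A t) : ENNReal.ofReal (treatProb P ht a h) =
      condDistrib (trtOf (L := L) ht) (histOf (L := L) (A := A) ht)
        (P : Measure (LongData L A τ)) h {a} := ofReal_measureReal

theorem regimeIndicator_nonneg (d : Policy L A) {k : ℕ} (hk : k ≤ τ) (s : Traj A k)
    (z : LongData L A τ) : 0 ≤ regimeIndicator d hk s z := by
  unfold regimeIndicator; split_ifs <;> norm_num

theorem ratioProd_nonneg (P : ProbabilityMeasure (LongData L A τ)) {k : ℕ} (hk : k ≤ τ)
    (s : Traj A k) (z : LongData L A τ) : 0 ≤ ratioProd P hk s z :=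
  Finset.prod_nonneg fun _ _ => div_nonneg (treatProb_nonneg ..) (treatProb_nonneg ..)

theorem weight_nonneg (d : Policy L A) (P : ProbabilityMeasure (LongData L A τ)) {k : ℕ}
    (hk : k ≤ τ) (s : Traj A k) (z : LongData L A τ) : 0 ≤ weight d P hk s z :=
  mul_nonneg (regimeIndicator_nonneg ..) (ratioProd_nonneg ..)

theorem weight_zero (d : Policy L A) (P : ProbabilityMeasure (LongData L A τ)) (h : 0 ≤ τ)
    (s : Traj A 0) (z : LongData L A τ) : weight d P h s z = 1 := by
  simp [weight, regimeIndicator, ratioProd]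

open scoped Classical in
-- The weight at `k` involves only covariates and treatments up to `k`, so the arbitrary later
-- values chosen by `Past.extend` do not matter. This exhibits the weight as a function of the past.
theorem weight_extend_pastOf (d : Policy L A) (P : ProbabilityMeasure (LongData L A τ)) {k : ℕ}
    (hk : k ≤ τ) (s : Traj A k) (z : LongData L A τ) :
    weight d P hk s (Past.extend τ (pastOf hk z)) = weight d P hk s z := by
  have h : regimeIndicator d hk s (Past.extend τ (pastOf hk z)) = regimeIndicator d hk s z := by
    unfold regimeIndicator
    refine if_congr (forall_congr' fun u => ?_) rfl rfl
    rw [histOf_extend_pastOf hk u.isLt z, trtOf_extend_pastOf hk u.isLt z]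
  simp only [weight, h, ratioProd, fun u : Fin k => histOf_extend_pastOf hk u.isLt z,
    fun u : Fin k => trtOf_extend_pastOf hk u.isLt z]

open scoped Classical in
theorem weight_snoc (d : Policy L A) (P : ProbabilityMeasure (LongData L A τ)) {k : ℕ}
    (hk : k < τ) (s : Traj A k) (a : A k) (z : LongData L A τ) :
    weight d P (Nat.succ_le_of_lt hk) (Traj.snoc s a) z =
      weight d P hk.le s z *
        ((if trtOf hk z = d k (Traj.snoc s a) (histOf hk z) then 1 else 0) *
          (treatProb P hk a (histOf hk z) / treatProb P hk (trtOf hk z) (histOf hk z))) := by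
  have h1 : regimeIndicator d (Nat.succ_le_of_lt hk) (Traj.snoc s a) z =
      regimeIndicator d hk.le s z *
        (if trtOf hk z = d k (Traj.snoc s a) (histOf hk z) then 1 else 0) := by
    unfold regimeIndicator
    rw [ite_zero_mul_ite_zero, mul_one]
    refine if_congr ?_ rfl rfl
    rw [Fin.forall_fin_succ']
    refine and_congr (forall_congr' fun u => ?_) Iff.rfl
    rw [← Traj.take_snoc (Nat.succ_le_of_lt u.isLt) s a]
    rfl
  have h2 : ratioProd P (Nat.succ_le_of_lt hk) (Traj.snoc s a) z =
      ratioProd P hk.le s z *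
        (treatProb P hk a (histOf hk z) / treatProb P hk (trtOf hk z) (histOf hk z)) := by
    unfold ratioProd
    rw [Fin.prod_univ_castSucc]
    simp only [Traj.snoc_castSucc, Traj.snoc_last]
  rw [weight, weight, h1, h2]
  ring

/-! ### Measurability of weights and regressions -/

theorem measurable_take {X : ℕ → Type*} [∀ t, MeasurableSpace (X t)] {k n : ℕ} (h : k ≤ n) :
    Measurable (Traj.take h : Traj X n → Traj X k) :=
  measurable_pi_lambda _ fun _ => measurable_pi_apply _

theorem measurable_snoc {X : ℕ → Type*} [∀ t, MeasurableSpace (X t)] {k : ℕ} :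
    Measurable (fun p : Traj X k × X k => Traj.snoc p.1 p.2) := by
  refine measurable_pi_lambda _ fun u => ?_
  refine Fin.lastCases ?_ (fun u => ?_) u
  · simp only [Traj.snoc_last]; exact measurable_snd
  · simp only [Traj.snoc_castSucc]; exact (measurable_pi_apply u).comp measurable_fst

theorem measurable_pastOf {k : ℕ} (h : k ≤ τ) : Measurable (pastOf (L := L) (A := A) h) :=
  ((measurable_take h).comp measurable_fst).prodMk
    ((measurable_take h).comp (measurable_fst.comp measurable_snd))

theorem measurable_histOf {t : ℕ} (h : t < τ) : Measurable (histOf (L := L) (A := A) h) :=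
  ((measurable_take _).comp measurable_fst).prodMk
    ((measurable_take _).comp (measurable_fst.comp measurable_snd))

theorem measurable_trtOf {t : ℕ} (h : t < τ) : Measurable (trtOf (L := L) (A := A) h) :=
  (measurable_pi_apply _).comp (measurable_fst.comp measurable_snd)

theorem measurable_outcome : Measurable (outcome (L := L) (A := A) (τ := τ)) :=
  measurable_snd.comp measurable_snd

theorem measurable_extend {k : ℕ} :
    Measurable (Past.extend τ : Past L A k → LongData L A τ) := by
  refine Measurable.prodMk (measurable_pi_lambda _ fun u => ?_)
    (Measurable.prodMk (measurable_pi_lambda _ fun u => ?_) measurable_const)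
  · by_cases h : (u : ℕ) < k
    · simp only [h, dite_true]; exact (measurable_pi_apply _).comp measurable_fst
    · simp only [h, dite_false]; exact measurable_const
  · by_cases h : (u : ℕ) < k
    · simp only [h, dite_true]; exact (measurable_pi_apply _).comp measurable_snd
    · simp only [h, dite_false]; exact measurable_const

theorem measurable_treatProb (P : ProbabilityMeasure (LongData L A τ)) {t : ℕ} (ht : t < τ)
    (a : A t) : Measurable (treatProb P ht a) :=
  (Kernel.measurable_coe _ (measurableSet_singleton a)).ennreal_toReal

theorem measurable_treatProb_trtOf (P : ProbabilityMeasure (LongData L A τ)) {t : ℕ} (ht : t < τ) :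
    Measurable fun z => treatProb P ht (trtOf ht z) (histOf ht z) := by
  have : Measurable (fun q : Hist L A t × A t => treatProb P ht q.2 q.1) :=
    measurable_from_prod_countable_left fun a => measurable_treatProb P ht a
  exact this.comp ((measurable_histOf ht).prodMk (measurable_trtOf ht))

variable {d : Policy L A}

theorem measurable_policy
    (hd : ∀ t, Measurable (fun x : Traj A (t + 1) × Hist L A t => d t x.1 x.2)) (t : ℕ)
    (s : Traj A (t + 1)) : Measurable (d t s) :=
  (hd t).comp measurable_prodMk_left

theorem measurable_regimeIndicator
    (hd : ∀ t, Measurable (fun x : Traj A (t + 1) × Hist L A t => d t x.1 x.2)) {k : ℕ}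
    (hk : k ≤ τ) (s : Traj A k) : Measurable (regimeIndicator (L := L) d hk s) := by
  unfold regimeIndicator
  refine Measurable.ite ?_ measurable_const measurable_const
  rw [Set.ofPred_forall]
  exact MeasurableSet.iInter fun u => measurableSet_eq_fun (measurable_trtOf _)
    ((measurable_policy hd _ _).comp (measurable_histOf _))

theorem measurable_ratioProd (P : ProbabilityMeasure (LongData L A τ)) {k : ℕ}
    (hk : k ≤ τ) (s : Traj A k) : Measurable (ratioProd P hk s) := by
  unfold ratioProd
  exact Finset.measurable_prod _ fun u _ =>
    ((measurable_treatProb P _ _).comp (measurable_histOf _)).div (measurable_treatProb_trtOf P _)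

theorem measurable_weight
    (hd : ∀ t, Measurable (fun x : Traj A (t + 1) × Hist L A t => d t x.1 x.2))
    (P : ProbabilityMeasure (LongData L A τ)) {k : ℕ}
    (hk : k ≤ τ) (s : Traj A k) : Measurable (weight d P hk s) :=
  (measurable_regimeIndicator hd hk s).mul (measurable_ratioProd P hk s)

theorem measurable_uncurry_of_countable {S E F : Type*} [MeasurableSpace S] [Countable S]
    [MeasurableSingletonClass S] [MeasurableSpace E] [MeasurableSpace F] {f : S → E → F}
    (hf : ∀ s, Measurable (f s)) : Measurable f.uncurry :=
  measurable_from_prod_countable_right hf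

theorem measurable_mReg_of_measurable_qReg (P : ProbabilityMeasure (LongData L A τ)) {k : ℕ}
    (hk : k ≤ τ) (s : Traj A k) (h : Measurable (qReg d P hk s)) : Measurable (mReg d P hk s) :=
  (MeasureTheory.StronglyMeasurable.integral_kernel_prod_right'
    (κ := condDistrib (fun z => z) (pastOf hk) (P : Measure (LongData L A τ)))
    (h.comp measurable_snd).stronglyMeasurable).measurable

/-- `(s̄_k, z)` is sent to `(s̄_{k+1}, a_{k+1}, h_{k+1})` with the natural treatment appended to
`s̄_k` and the intervened treatment in place of `a_{k+1}`. -/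
def interveneOnce (d : Policy L A) {k : ℕ} (hk : k < τ) (y : Traj A k × LongData L A τ) :
    Traj A (k + 1) × Past L A (k + 1) :=
  (Traj.snoc y.1 (trtOf hk y.2), (histOf hk y.2).1,
    Traj.snoc (histOf hk y.2).2 (d k (Traj.snoc y.1 (trtOf hk y.2)) (histOf hk y.2)))

theorem measurable_interveneOnce
    (hd : ∀ t, Measurable (fun x : Traj A (t + 1) × Hist L A t => d t x.1 x.2)) {k : ℕ}
    (hk : k < τ) : Measurable (interveneOnce (L := L) d hk) := by
  have h1 : Measurable fun y : Traj A k × LongData L A τ => Traj.snoc y.1 (trtOf hk y.2) :=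
    measurable_snoc.comp (measurable_fst.prodMk ((measurable_trtOf hk).comp measurable_snd))
  have h2 : Measurable fun y : Traj A k × LongData L A τ => histOf hk y.2 :=
    (measurable_histOf hk).comp measurable_snd
  exact h1.prodMk ((measurable_fst.comp h2).prodMk
    (measurable_snoc.comp ((measurable_snd.comp h2).prodMk ((hd k).comp (h1.prodMk h2)))))

theorem qReg_eq_mReg_interveneOnce (P : ProbabilityMeasure (LongData L A τ)) {k : ℕ}
    (hk : k < τ) (y : Traj A k × LongData L A τ) :
    qReg d P hk.le y.1 y.2 =
      (mReg d P (Nat.succ_le_of_lt hk)).uncurry (interveneOnce d hk y) :=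
  qReg_of_lt d P hk y.1 y.2

/-- Backward induction on the number `j` of remaining time points. The natural history ranges over a
countable set, so measurability for each fixed `s` suffices. -/
theorem measurable_qReg
    (hd : ∀ t, Measurable (fun x : Traj A (t + 1) × Hist L A t => d t x.1 x.2))
    (P : ProbabilityMeasure (LongData L A τ)) {k : ℕ} (hk : k ≤ τ) (s : Traj A k) :
    Measurable (qReg d P hk s) := by
  obtain ⟨j, hj⟩ := Nat.exists_eq_add_of_le hk
  induction j generalizing k with
  | zero =>
    obtain rfl : k = τ := hj.symm
    rw [show qReg d P hk s = outcome from funext fun z => qReg_self d P s z]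
    exact measurable_outcome
  | succ j ih =>
    have hk' : k < τ := by omega
    have h : Measurable (mReg d P (Nat.succ_le_of_lt hk')).uncurry :=
      measurable_uncurry_of_countable fun s =>
        measurable_mReg_of_measurable_qReg P _ s (ih _ s (by omega))
    have := (h.comp (measurable_interveneOnce hd hk')).comp (measurable_prodMk_left (x := s))
    rwa [show qReg d P hk s = _ from funext fun z => qReg_eq_mReg_interveneOnce P hk' (s, z)]

theorem measurable_mReg
    (hd : ∀ t, Measurable (fun x : Traj A (t + 1) × Hist L A t => d t x.1 x.2))
    (P : ProbabilityMeasure (LongData L A τ)) {k : ℕ} (hk : k ≤ τ) (s : Traj A k) :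
    Measurable (mReg d P hk s) :=
  measurable_mReg_of_measurable_qReg P hk s (measurable_qReg hd P hk s)

end Weight

/-! ### One step of the g-formula -/

section ChangeOfVariables

variable {L A : ℕ → Type*} {τ : ℕ}
variable [∀ t, MeasurableSpace (L t)] [∀ t, StandardBorelSpace (L t)] [∀ t, Nonempty (L t)]
  [∀ t, MeasurableSpace (A t)] [∀ t, DiscreteMeasurableSpace (A t)] [∀ t, Countable (A t)]
  [∀ t, Nonempty (A t)]
variable {d : Policy L A}

theorem regimeIndicator_eq_one_and_treatProb_pos_of_weight_pos
    {P : ProbabilityMeasure (LongData L A τ)} {k : ℕ}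
    (hk : k ≤ τ) {s : Traj A k} {z : LongData L A τ} (h : 0 < weight d P hk s z) :
    regimeIndicator d hk s z = 1 ∧
      ∀ u : Fin k, 0 < treatProb P (u.isLt.trans_le hk) (s u) (histOf (u.isLt.trans_le hk) z) := by
  have h1 : regimeIndicator d hk s z ≠ 0 := fun h0 => by simp [weight, h0] at h
  have h2 : ratioProd P hk s z ≠ 0 := fun h0 => by simp [weight, h0] at h
  refine ⟨?_, fun u => (treatProb_nonneg ..).lt_of_ne' fun h0 => ?_⟩
  · revert h1
    unfold regimeIndicator
    split_ifs <;> simp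
  · exact h2 (Finset.prod_eq_zero (Finset.mem_univ u) (by rw [h0, zero_div]))

/-- A positive weight already encodes that the regime was followed and that the natural path has
positive probability, which are the premises of positivity. -/
theorem Positivity.ae_treatProb_policy_pos {P : ProbabilityMeasure (LongData L A τ)}
    (hpos : Positivity d P) {k : ℕ} (hk : k < τ) (s : Traj A k) (a : A k) :
    ∀ᵐ z ∂(P : Measure (LongData L A τ)), 0 < weight d P hk.le s z →
      0 < treatProb P hk a (histOf hk z) →
      0 < treatProb P hk (d k (Traj.snoc s a) (histOf hk z)) (histOf hk z) := by
  filter_upwards [hpos k hk] with z hz hw ha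
  obtain ⟨h1, h2⟩ := regimeIndicator_eq_one_and_treatProb_pos_of_weight_pos hk.le hw
  refine hz (Traj.snoc s a) ?_ fun u => ?_
  · rwa [Traj.take_snoc le_rfl]
  · refine Fin.lastCases ?_ (fun u => ?_) u
    · rw [Traj.snoc_last]; exact ha
    · rw [Traj.snoc_castSucc]; exact h2 u

open scoped Classical in
-- Conditionally on the history, the indicator selects the intervened treatment, whose probability
-- cancels the denominator and leaves `g(a)`. Summing over `a` with these probabilities is the same
-- as averaging over the natural treatment, so `a` becomes the observed treatment.
theorem tsum_lintegral_weight_snoc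
    (hd : ∀ t, Measurable (fun x : Traj A (t + 1) × Hist L A t => d t x.1 x.2))
    {P : ProbabilityMeasure (LongData L A τ)} (hpos : Positivity d P) {k : ℕ} (hk : k < τ)
    {f : Traj A (k + 1) × Past L A (k + 1) → ℝ≥0∞} (hf : Measurable f) (s : Traj A k) :
    ∑' a, ∫⁻ z, ENNReal.ofReal (weight d P (Nat.succ_le_of_lt hk) (Traj.snoc s a) z) *
        f (Traj.snoc s a, pastOf (Nat.succ_le_of_lt hk) z) ∂(P : Measure (LongData L A τ)) =
      ∫⁻ z, ENNReal.ofReal (weight d P hk.le s z) * f (interveneOnce d hk (s, z))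
        ∂(P : Measure (LongData L A τ)) := by
  -- A history has one covariate more than the past on which the weight depends; it is dropped
  -- before extending.
  let w : Hist L A k → ℝ := fun h =>
    weight d P hk.le s (Past.extend τ (Traj.take (Nat.le_succ k) h.1, h.2))
  have hw : ∀ z, weight d P hk.le s z = w (histOf hk z) := fun z =>
    (weight_extend_pastOf d P hk.le s z).symm
  have hwm : Measurable w := (measurable_weight hd P hk.le s).comp
    (measurable_extend.comp (((measurable_take _).comp measurable_fst).prodMk measurable_snd))
  have hg : ∀ a, Measurable (treatProb P hk a) := measurable_treatProb P hk
  have hsn : ∀ {k : ℕ} (b : A k), Measurable fun h : Hist L A k => Traj.snoc h.2 b := fun b =>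
    measurable_snoc.comp (measurable_snd.prodMk measurable_const)
  have hsd : ∀ a, Measurable fun h : Hist L A k => Traj.snoc h.2 (d k (Traj.snoc s a) h) :=
    fun a => measurable_snoc.comp (measurable_snd.prodMk (measurable_policy hd k _))
  let G : A k → Hist L A k → A k → ℝ≥0∞ := fun a h b =>
    ENNReal.ofReal (w h * ((if b = d k (Traj.snoc s a) h then 1 else 0) *
      (treatProb P hk a h / treatProb P hk b h))) * f (Traj.snoc s a, h.1, Traj.snoc h.2 b)
  let G' : Hist L A k → A k → ℝ≥0∞ := fun h a =>
    ENNReal.ofReal (w h) * f (Traj.snoc s a, h.1, Traj.snoc h.2 (d k (Traj.snoc s a) h))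
  have hG : ∀ a b, Measurable fun h => G a h b := fun a b => by
    refine Measurable.mul (Measurable.ennreal_ofReal (hwm.mul (Measurable.mul ?_ ((hg a).div (hg b)))))
      (hf.comp (measurable_const.prodMk (measurable_fst.prodMk (hsn b))))
    exact Measurable.ite (measurableSet_eq_fun measurable_const (measurable_policy hd k _))
      measurable_const measurable_const
  have hG' : ∀ a, Measurable fun h => G' h a := fun a =>
    hwm.ennreal_ofReal.mul (hf.comp (measurable_const.prodMk (measurable_fst.prodMk (hsd a))))
  have hl : ∀ a, ∫⁻ z, ENNReal.ofReal (weight d P (Nat.succ_le_of_lt hk) (Traj.snoc s a) z) *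
        f (Traj.snoc s a, pastOf (Nat.succ_le_of_lt hk) z) ∂(P : Measure (LongData L A τ)) =
      ∫⁻ z, ENNReal.ofReal (treatProb P hk a (histOf hk z)) * G' (histOf hk z) a
        ∂(P : Measure (LongData L A τ)) := by
    intro a
    have h1 : ∀ z, ENNReal.ofReal (weight d P (Nat.succ_le_of_lt hk) (Traj.snoc s a) z) *
        f (Traj.snoc s a, pastOf (Nat.succ_le_of_lt hk) z) = G a (histOf hk z) (trtOf hk z) :=
      fun z => by rw [weight_snoc d P hk s a z, hw, pastOf_succ hk]
    simp_rw [h1]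
    rw [lintegral_eq_lintegral_tsum_condDistrib _ (measurable_histOf hk) (measurable_trtOf hk)
      (hG a)]
    refine lintegral_congr_ae ?_
    filter_upwards [hpos.ae_treatProb_policy_pos hk s a] with z hz
    set h := histOf hk z
    -- Only the intervened value survives the indicator.
    rw [tsum_eq_single (d k (Traj.snoc s a) h)
      (fun b hb => by simp only [G, if_neg hb, zero_mul, mul_zero, ENNReal.ofReal_zero])]
    rw [← ofReal_treatProb]
    simp only [G, G', if_true, one_mul]
    rw [← mul_assoc, ← mul_assoc, ← ENNReal.ofReal_mul (treatProb_nonneg ..),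
      ← ENNReal.ofReal_mul (treatProb_nonneg ..)]
    congr 2
    -- The probability of the intervened treatment can be cancelled only if it is nonzero.
    -- Positivity ensures this unless the weight or `g(a)` vanishes, and then both sides are zero.
    by_cases hw0 : w h = 0
    · simp [hw0]
    by_cases ha0 : treatProb P hk a h = 0
    · simp [ha0]
    have hw' : 0 < weight d P hk.le s z :=
      (weight_nonneg ..).lt_of_ne' (by rw [hw]; exact hw0)
    have := (hz hw' ((treatProb_nonneg ..).lt_of_ne' ha0)).ne'
    field_simp
  simp_rw [hl]
  have h2 : ∀ z, ENNReal.ofReal (weight d P hk.le s z) * f (interveneOnce d hk (s, z)) =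
      G' (histOf hk z) (trtOf hk z) := fun z => by simp only [G', hw, interveneOnce]
  simp_rw [h2]
  rw [lintegral_eq_lintegral_tsum_condDistrib _ (measurable_histOf hk) (measurable_trtOf hk) hG',
    lintegral_tsum (f := fun a z => condDistrib (trtOf hk) (histOf hk)
      (P : Measure (LongData L A τ)) (histOf hk z) {a} * G' (histOf hk z) a) fun a =>
        (((Kernel.measurable_coe _ (measurableSet_singleton a)).mul (hG' a)).comp
          (measurable_histOf hk)).aemeasurable]
  simp_rw [ofReal_treatProb]

theorem lintegral_weight_succ
    (hd : ∀ t, Measurable (fun x : Traj A (t + 1) × Hist L A t => d t x.1 x.2))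
    {P : ProbabilityMeasure (LongData L A τ)} (hpos : Positivity d P) {k : ℕ} (hk : k < τ)
    {f : Traj A (k + 1) × Past L A (k + 1) → ℝ≥0∞} (hf : Measurable f) :
    ∫⁻ y, ENNReal.ofReal (weight d P (Nat.succ_le_of_lt hk) y.1 y.2) *
        f (y.1, pastOf (Nat.succ_le_of_lt hk) y.2)
          ∂(Measure.count.prod (P : Measure (LongData L A τ))) =
      ∫⁻ y, ENNReal.ofReal (weight d P hk.le y.1 y.2) * f (interveneOnce d hk y)
        ∂(Measure.count.prod (P : Measure (LongData L A τ))) := by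
  have hw : ∀ {k : ℕ} (hk : k ≤ τ),
      Measurable fun y : Traj A k × LongData L A τ => weight d P hk y.1 y.2 := fun hk =>
    measurable_uncurry_of_countable (measurable_weight hd P hk)
  have h1 : Measurable fun y : Traj A (k + 1) × LongData L A τ =>
      ENNReal.ofReal (weight d P (Nat.succ_le_of_lt hk) y.1 y.2) *
        f (y.1, pastOf (Nat.succ_le_of_lt hk) y.2) :=
    (hw _).ennreal_ofReal.mul
      (hf.comp (measurable_fst.prodMk ((measurable_pastOf _).comp measurable_snd)))
  have h2 : Measurable fun y : Traj A k × LongData L A τ =>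
      ENNReal.ofReal (weight d P hk.le y.1 y.2) * f (interveneOnce d hk y) :=
    (hw _).ennreal_ofReal.mul (hf.comp (measurable_interveneOnce hd hk))
  rw [lintegral_prod _ h1.aemeasurable, lintegral_prod _ h2.aemeasurable, lintegral_count, lintegral_count, ← (Traj.snocEquiv A k).tsum_eq, ENNReal.tsum_prod']
  exact tsum_congr fun s => tsum_lintegral_weight_snoc hd hpos hk hf s

/-- The measure `W_k dP` on pairs of a natural treatment history `s̄_k` and a data point. -/
def weightMeasure (d : Policy L A) (P : ProbabilityMeasure (LongData L A τ)) {k : ℕ}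
    (hk : k ≤ τ) : Measure (Traj A k × LongData L A τ) :=
  (Measure.count.prod (P : Measure (LongData L A τ))).withDensity
    fun y => (weight d P hk y.1 y.2).toNNReal

theorem measurable_weight_uncurry
    (hd : ∀ t, Measurable (fun x : Traj A (t + 1) × Hist L A t => d t x.1 x.2))
    (P : ProbabilityMeasure (LongData L A τ)) {k : ℕ} (hk : k ≤ τ) :
    Measurable fun y : Traj A k × LongData L A τ => weight d P hk y.1 y.2 :=
  measurable_uncurry_of_countable (measurable_weight hd P hk)

theorem integrable_weightMeasure_iff
    (hd : ∀ t, Measurable (fun x : Traj A (t + 1) × Hist L A t => d t x.1 x.2))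
    (P : ProbabilityMeasure (LongData L A τ)) {k : ℕ} (hk : k ≤ τ)
    {f : Traj A k × LongData L A τ → ℝ} :
    Integrable f (weightMeasure d P hk) ↔
      Integrable (fun y => weight d P hk y.1 y.2 * f y)
        (Measure.count.prod (P : Measure (LongData L A τ))) := by
  rw [weightMeasure,
    integrable_withDensity_iff_integrable_smul (measurable_weight_uncurry hd P hk).real_toNNReal]
  refine integrable_congr (ae_of_all _ fun y => ?_)
  simp [NNReal.smul_def, Real.coe_toNNReal _ (weight_nonneg d P hk y.1 y.2)]

theorem integral_weightMeasure
    (hd : ∀ t, Measurable (fun x : Traj A (t + 1) × Hist L A t => d t x.1 x.2))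
    (P : ProbabilityMeasure (LongData L A τ)) {k : ℕ} (hk : k ≤ τ)
    (f : Traj A k × LongData L A τ → ℝ) :
    ∫ y, f y ∂(weightMeasure d P hk) =
      ∫ y, weight d P hk y.1 y.2 * f y
        ∂(Measure.count.prod (P : Measure (LongData L A τ))) := by
  rw [weightMeasure,
    integral_withDensity_eq_integral_smul (measurable_weight_uncurry hd P hk).real_toNNReal]
  refine integral_congr_ae (ae_of_all _ fun y => ?_)
  simp [NNReal.smul_def, Real.coe_toNNReal _ (weight_nonneg d P hk y.1 y.2)]

/-- One step of the g-formula: changing the treatment at time index `k` to the intervened one. -/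
theorem map_weightMeasure_succ
    (hd : ∀ t, Measurable (fun x : Traj A (t + 1) × Hist L A t => d t x.1 x.2))
    {P : ProbabilityMeasure (LongData L A τ)} (hpos : Positivity d P) {k : ℕ} (hk : k < τ) :
    (weightMeasure d P (Nat.succ_le_of_lt hk)).map
        (fun y => (y.1, pastOf (Nat.succ_le_of_lt hk) y.2)) =
      (weightMeasure d P hk.le).map (interveneOnce d hk) := by
  have hpm : Measurable fun y : Traj A (k + 1) × LongData L A τ =>
      (y.1, pastOf (Nat.succ_le_of_lt hk) y.2) :=
    measurable_fst.prodMk ((measurable_pastOf _).comp measurable_snd)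
  refine Measure.ext_of_lintegral _ fun f hf => ?_
  have h1 : Measurable fun y : Traj A (k + 1) × LongData L A τ =>
      f (y.1, pastOf (Nat.succ_le_of_lt hk) y.2) := hf.comp hpm
  have h2 : Measurable fun y : Traj A k × LongData L A τ => f (interveneOnce d hk y) :=
    hf.comp (measurable_interveneOnce hd hk)
  rw [lintegral_map hf hpm, lintegral_map hf (measurable_interveneOnce hd hk), weightMeasure,
    weightMeasure, lintegral_withDensity_eq_lintegral_mul _
      (measurable_weight_uncurry hd P _).real_toNNReal.coe_nnreal_ennreal h1,
    lintegral_withDensity_eq_lintegral_mul _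
      (measurable_weight_uncurry hd P _).real_toNNReal.coe_nnreal_ennreal h2]
  exact lintegral_weight_succ hd hpos hk hf

end ChangeOfVariables

/-! ### Telescoping and the identification formula -/

section GFormula

variable {L A : ℕ → Type*} {τ : ℕ}
variable [∀ t, MeasurableSpace (L t)] [∀ t, StandardBorelSpace (L t)] [∀ t, Nonempty (L t)]
  [∀ t, MeasurableSpace (A t)] [∀ t, DiscreteMeasurableSpace (A t)] [∀ t, Countable (A t)]
  [∀ t, Nonempty (A t)]
variable {d : Policy L A}

theorem measurable_mReg_pastOf
    (hd : ∀ t, Measurable (fun x : Traj A (t + 1) × Hist L A t => d t x.1 x.2))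
    (P : ProbabilityMeasure (LongData L A τ)) {k : ℕ} (hk : k ≤ τ) :
    Measurable fun y : Traj A k × LongData L A τ => mReg d P hk y.1 (pastOf hk y.2) :=
  (measurable_uncurry_of_countable (measurable_mReg hd P hk)).comp
    (measurable_fst.prodMk ((measurable_pastOf hk).comp measurable_snd))

theorem measurable_qReg_uncurry
    (hd : ∀ t, Measurable (fun x : Traj A (t + 1) × Hist L A t => d t x.1 x.2))
    (P : ProbabilityMeasure (LongData L A τ)) {k : ℕ} (hk : k ≤ τ) :
    Measurable fun y : Traj A k × LongData L A τ => qReg d P hk y.1 y.2 :=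
  measurable_uncurry_of_countable (measurable_qReg hd P hk)

/-- Both integrands are the same function of (natural history, past), composed with the two maps
whose image measures agree by `map_weightMeasure_succ`. Positivity is needed for `Q`, whose weights
appear, while `P` is arbitrary. -/
theorem integrable_mReg_succ_iff
    (hd : ∀ t, Measurable (fun x : Traj A (t + 1) × Hist L A t => d t x.1 x.2))
    {Q : ProbabilityMeasure (LongData L A τ)} (hpos : Positivity d Q)
    (P : ProbabilityMeasure (LongData L A τ)) {k : ℕ} (hk : k < τ) :
    Integrable (fun y => mReg d P (Nat.succ_le_of_lt hk) y.1 (pastOf (Nat.succ_le_of_lt hk) y.2))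
        (weightMeasure d Q (Nat.succ_le_of_lt hk)) ↔
      Integrable (fun y => qReg d P hk.le y.1 y.2) (weightMeasure d Q hk.le) := by
  have hm := measurable_uncurry_of_countable (measurable_mReg hd P (Nat.succ_le_of_lt hk))
  have hpm : Measurable fun y : Traj A (k + 1) × LongData L A τ =>
      (y.1, pastOf (Nat.succ_le_of_lt hk) y.2) :=
    measurable_fst.prodMk ((measurable_pastOf _).comp measurable_snd)
  have h1 := integrable_map_measure (μ := weightMeasure d Q (Nat.succ_le_of_lt hk))
    hm.aestronglyMeasurable hpm.aemeasurable
  have h2 := integrable_map_measure (μ := weightMeasure d Q hk.le)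
    hm.aestronglyMeasurable (measurable_interveneOnce hd hk).aemeasurable
  rw [map_weightMeasure_succ hd hpos hk, h2] at h1
  rw [show (fun y : Traj A k × LongData L A τ => qReg d P hk.le y.1 y.2) = _ from
    funext fun y => qReg_eq_mReg_interveneOnce P hk y]
  exact h1.symm

theorem integral_mReg_succ
    (hd : ∀ t, Measurable (fun x : Traj A (t + 1) × Hist L A t => d t x.1 x.2))
    {Q : ProbabilityMeasure (LongData L A τ)} (hpos : Positivity d Q)
    (P : ProbabilityMeasure (LongData L A τ)) {k : ℕ} (hk : k < τ) :
    ∫ y, mReg d P (Nat.succ_le_of_lt hk) y.1 (pastOf (Nat.succ_le_of_lt hk) y.2)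
        ∂(weightMeasure d Q (Nat.succ_le_of_lt hk)) =
      ∫ y, qReg d P hk.le y.1 y.2 ∂(weightMeasure d Q hk.le) := by
  have hm := measurable_uncurry_of_countable (measurable_mReg hd P (Nat.succ_le_of_lt hk))
  have hpm : Measurable fun y : Traj A (k + 1) × LongData L A τ =>
      (y.1, pastOf (Nat.succ_le_of_lt hk) y.2) :=
    measurable_fst.prodMk ((measurable_pastOf _).comp measurable_snd)
  have h1 := integral_map (μ := weightMeasure d Q (Nat.succ_le_of_lt hk)) hpm.aemeasurable
    hm.aestronglyMeasurable
  have h2 := integral_map (μ := weightMeasure d Q hk.le)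
    (measurable_interveneOnce hd hk).aemeasurable hm.aestronglyMeasurable
  rw [map_weightMeasure_succ hd hpos hk, h2] at h1
  rw [show (fun y : Traj A k × LongData L A τ => qReg d P hk.le y.1 y.2) = _ from
    funext fun y => qReg_eq_mReg_interveneOnce P hk y]
  exact h1.symm

/-- The weights of any law `Q` are functions of the past, hence the regression of `P` may replace
the regressand under `P`. -/
theorem integrable_and_integral_weight_mul_mReg
    (hd : ∀ t, Measurable (fun x : Traj A (t + 1) × Hist L A t => d t x.1 x.2))
    (P Q : ProbabilityMeasure (LongData L A τ)) {k : ℕ} (hk : k ≤ τ)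
    (hint : Integrable (fun y => weight d Q hk y.1 y.2 * qReg d P hk y.1 y.2)
      (Measure.count.prod (P : Measure (LongData L A τ)))) :
    Integrable (fun y => weight d Q hk y.1 y.2 * mReg d P hk y.1 (pastOf hk y.2))
        (Measure.count.prod (P : Measure (LongData L A τ))) ∧
      ∫ y, weight d Q hk y.1 y.2 * mReg d P hk y.1 (pastOf hk y.2)
          ∂(Measure.count.prod (P : Measure (LongData L A τ))) =
        ∫ y, weight d Q hk y.1 y.2 * qReg d P hk y.1 y.2
          ∂(Measure.count.prod (P : Measure (LongData L A τ))) := by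
  have hw : Measurable fun p : Traj A k × Past L A k =>
      weight d Q hk p.1 (Past.extend τ p.2) :=
    (measurable_weight_uncurry hd Q hk).comp
      (measurable_fst.prodMk (measurable_extend.comp measurable_snd))
  have h := integrable_and_integral_condDistrib_of_count_prod (P : Measure (LongData L A τ))
    (measurable_pastOf hk) hw (F := fun s z => qReg d P hk s z)
    (measurable_qReg_uncurry hd P hk)
    (by simpa only [weight_extend_pastOf] using hint)
  simp only [weight_extend_pastOf] at h
  exact h

theorem integrable_and_integral_mReg
    (hd : ∀ t, Measurable (fun x : Traj A (t + 1) × Hist L A t => d t x.1 x.2))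
    (P : ProbabilityMeasure (LongData L A τ)) {k : ℕ} (hk : k ≤ τ)
    (hint : Integrable (fun y => qReg d P hk y.1 y.2) (weightMeasure d P hk)) :
    Integrable (fun y => mReg d P hk y.1 (pastOf hk y.2)) (weightMeasure d P hk) ∧
      ∫ y, mReg d P hk y.1 (pastOf hk y.2) ∂(weightMeasure d P hk) =
        ∫ y, qReg d P hk y.1 y.2 ∂(weightMeasure d P hk) := by
  rw [integrable_weightMeasure_iff hd] at hint ⊢
  rw [integral_weightMeasure hd, integral_weightMeasure hd]
  exact integrable_and_integral_weight_mul_mReg hd P P hk hint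

theorem FiniteInterventionMean.integrable_outcome
    (hd : ∀ t, Measurable (fun x : Traj A (t + 1) × Hist L A t => d t x.1 x.2))
    {P : ProbabilityMeasure (LongData L A τ)} (hfin : FiniteInterventionMean d P) :
    Integrable (fun y => outcome y.2) (weightMeasure d P le_rfl) := by
  have hm : Measurable fun y : Traj A τ × LongData L A τ =>
      weight d P le_rfl y.1 y.2 * outcome y.2 :=
    (measurable_weight_uncurry hd P le_rfl).mul (measurable_outcome.comp measurable_snd)
  rw [integrable_weightMeasure_iff hd]
  refine ⟨hm.aestronglyMeasurable, ?_⟩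
  -- Tonelli, with the sum over natural histories inside, as in `FiniteInterventionMean`.
  rw [HasFiniteIntegral, lintegral_prod_symm _ hm.enorm.aemeasurable]
  refine lt_of_eq_of_lt (lintegral_congr fun z => ?_) hfin
  rw [lintegral_count]
  refine tsum_congr fun s => ?_
  rw [Real.enorm_eq_ofReal_abs, abs_mul, abs_of_nonneg (weight_nonneg ..)]
  rfl

/-- Backward induction: conditioning keeps integrability when passing from `q` to `m` at the same
time, and the change of variables carries it to `q` one time earlier. -/
theorem integrable_qReg_of_integrable_outcome
    (hd : ∀ t, Measurable (fun x : Traj A (t + 1) × Hist L A t => d t x.1 x.2))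
    {P : ProbabilityMeasure (LongData L A τ)} (hpos : Positivity d P)
    (hint : Integrable (fun y => outcome y.2) (weightMeasure d P le_rfl)) {k : ℕ} (hk : k ≤ τ) :
    Integrable (fun y => qReg d P hk y.1 y.2) (weightMeasure d P hk) := by
  obtain ⟨j, hj⟩ := Nat.exists_eq_add_of_le hk
  induction j generalizing k with
  | zero =>
    obtain rfl : k = τ := hj.symm
    simpa only [qReg_self] using hint
  | succ j ih =>
    have hk' : k < τ := by omega
    rw [← integrable_mReg_succ_iff hd hpos P hk']
    exact (integrable_and_integral_mReg hd P _ (ih _ (by omega))).1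

/-- There is exactly one empty natural history, and its weight is `1`. -/
theorem integrable_and_integral_weightMeasure_zero
    (hd : ∀ t, Measurable (fun x : Traj A (t + 1) × Hist L A t => d t x.1 x.2))
    (Q : ProbabilityMeasure (LongData L A τ)) {F : Traj A 0 → LongData L A τ → ℝ}
    (hint : Integrable F.uncurry (weightMeasure d Q (Nat.zero_le τ))) :
    Integrable (F fun u => u.elim0) (Q : Measure (LongData L A τ)) ∧
      ∫ y, F.uncurry y ∂(weightMeasure d Q (Nat.zero_le τ)) =
        ∫ z, F (fun u => u.elim0) z ∂(Q : Measure (LongData L A τ)) := by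
  rw [integrable_weightMeasure_iff hd] at hint
  rw [integral_weightMeasure hd]
  simp only [weight_zero, one_mul] at hint ⊢
  have h := integrable_tsum_of_count_prod _ hint
  have hu : ∀ z, ∑' s, F s z = F (fun u => u.elim0) z := fun z => by
    rw [tsum_eq_single (fun u => u.elim0) fun s hs => (hs (funext fun u => u.elim0)).elim]
  simp only [hu] at h
  exact ⟨h.1, h.2.symm⟩

/-- Telescoping: the regressions are those of `P`, the weights those of `Q`. -/
theorem integral_qReg_eq_sum
    (hd : ∀ t, Measurable (fun x : Traj A (t + 1) × Hist L A t => d t x.1 x.2))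
    {Q : ProbabilityMeasure (LongData L A τ)} (hpos : Positivity d Q)
    (P : ProbabilityMeasure (LongData L A τ))
    (hint : ∀ (k : ℕ) (hk : k ≤ τ),
      Integrable (fun y => qReg d P hk y.1 y.2) (weightMeasure d Q hk)) {k : ℕ} (hk : k ≤ τ) :
    ∫ y, qReg d P hk y.1 y.2 ∂(weightMeasure d Q hk) =
      ∑ j : Fin k, ∫ y, (qReg d P (Nat.succ_le_of_lt (j.isLt.trans_le hk)) y.1 y.2 -
          mReg d P (Nat.succ_le_of_lt (j.isLt.trans_le hk)) y.1
            (pastOf (Nat.succ_le_of_lt (j.isLt.trans_le hk)) y.2))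
        ∂(weightMeasure d Q (Nat.succ_le_of_lt (j.isLt.trans_le hk))) +
      ∫ z, qReg d P (Nat.zero_le τ) (fun u => u.elim0) z ∂(Q : Measure (LongData L A τ)) := by
  induction k with
  | zero =>
    rw [Fin.sum_univ_zero, zero_add]
    exact (integrable_and_integral_weightMeasure_zero hd Q (hint 0 hk)).2
  | succ k ih =>
    have hk' : k < τ := hk
    have h1 := integral_sub (hint (k + 1) hk)
      ((integrable_mReg_succ_iff hd hpos P hk').2 (hint k hk'.le))
    -- The subtracted regression term is the weighted integral of the preceding `q`, to which the
    -- induction hypothesis applies.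
    rw [integral_mReg_succ hd hpos P hk', ih hk'.le] at h1
    rw [Fin.sum_univ_castSucc]
    simp only [Fin.val_castSucc, Fin.val_last]
    linarith

/-- The inverse-probability-weighted form of the parameter: telescope with the regressions of `Q`
itself, whose residuals integrate to zero. -/
theorem theta_eq_integral_outcome
    (hd : ∀ t, Measurable (fun x : Traj A (t + 1) × Hist L A t => d t x.1 x.2))
    {Q : ProbabilityMeasure (LongData L A τ)} (hpos : Positivity d Q)
    (hint : Integrable (fun y => outcome y.2) (weightMeasure d Q le_rfl)) :
    theta d Q = ∫ y, outcome y.2 ∂(weightMeasure d Q le_rfl) := by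
  have hq : ∀ (k : ℕ) (hk : k ≤ τ),
      Integrable (fun y => qReg d Q hk y.1 y.2) (weightMeasure d Q hk) := fun k hk =>
    integrable_qReg_of_integrable_outcome hd hpos hint hk
  have h := integral_qReg_eq_sum hd hpos Q hq le_rfl
  rw [Finset.sum_eq_zero, zero_add] at h
  · simp only [qReg_self] at h
    exact h.symm
  · intro j _
    have hj := integrable_and_integral_mReg hd Q (Nat.succ_le_of_lt j.isLt) (hq _ _)
    rw [integral_sub (hq _ _) hj.1, hj.2, sub_self]

/-- The value at `Q` in terms of the regressions of `P`: `Q` enters only through its weights and as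
the integrating measure, so the regressions of `Q` never have to be compared with those of `P`. -/
theorem theta_eq_sum_add_integral
    (hd : ∀ t, Measurable (fun x : Traj A (t + 1) × Hist L A t => d t x.1 x.2))
    {Q : ProbabilityMeasure (LongData L A τ)} (hpos : Positivity d Q)
    (P : ProbabilityMeasure (LongData L A τ))
    (hint : ∀ (k : ℕ) (hk : k ≤ τ),
      Integrable (fun y => qReg d P hk y.1 y.2) (weightMeasure d Q hk)) :
    theta d Q =
      ∑ j : Fin τ, ∫ y, (qReg d P (Nat.succ_le_of_lt j.isLt) y.1 y.2 -
          mReg d P (Nat.succ_le_of_lt j.isLt) y.1 (pastOf (Nat.succ_le_of_lt j.isLt) y.2))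
        ∂(weightMeasure d Q (Nat.succ_le_of_lt j.isLt)) +
      ∫ z, qReg d P (Nat.zero_le τ) (fun u => u.elim0) z ∂(Q : Measure (LongData L A τ)) := by
  have h := hint τ le_rfl
  have h' := integral_qReg_eq_sum hd hpos P hint le_rfl
  simp only [qReg_self] at h h'
  rw [theta_eq_integral_outcome hd hpos h, h']

end GFormula

/-! ### Comparison of the weights of two laws -/

section Comparison

variable {L A : ℕ → Type*} {τ : ℕ}
variable [∀ t, MeasurableSpace (L t)] [∀ t, StandardBorelSpace (L t)] [∀ t, Nonempty (L t)]
  [∀ t, MeasurableSpace (A t)] [∀ t, DiscreteMeasurableSpace (A t)] [∀ t, Countable (A t)]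
  [∀ t, Nonempty (A t)]
variable {d : Policy L A}

theorem ae_treatProb_le {P Q : ProbabilityMeasure (LongData L A τ)} {b b' : ℝ≥0}
    (hb : (Q : Measure (LongData L A τ)) ≤ (b : ℝ≥0∞) • (P : Measure (LongData L A τ)))
    (hb' : (P : Measure (LongData L A τ)) ≤ (b' : ℝ≥0∞) • (Q : Measure (LongData L A τ))) :
    ∀ᵐ z ∂(Q : Measure (LongData L A τ)), ∀ (t : ℕ) (ht : t < τ) (a : A t),
      treatProb Q ht a (histOf ht z) ≤ (b * b' : ℝ≥0) * treatProb P ht a (histOf ht z) := by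
  rw [ae_all_iff]
  intro t
  by_cases ht : t < τ
  · filter_upwards [condDistrib_singleton_le_of_le_smul (measurable_histOf (L := L) (A := A) ht)
      (measurable_trtOf ht) hb hb'] with z hz _ a
    have h := hz a
    rw [← ofReal_treatProb, ← ofReal_treatProb, ← ENNReal.coe_mul, ← ENNReal.ofReal_coe_nnreal,
      ← ENNReal.ofReal_mul (NNReal.coe_nonneg _)] at h
    exact (ENNReal.ofReal_le_ofReal_iff
      (mul_nonneg (NNReal.coe_nonneg _) (treatProb_nonneg ..))).1 h
  · exact ae_of_all _ fun z h => absurd h ht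

/-- The treatment mechanisms of `P` and `Q` differ by a factor of at most `l` in either
direction, along the histories of `z`. -/
def TreatProbComparable (P Q : ProbabilityMeasure (LongData L A τ)) (l : ℝ)
    (z : LongData L A τ) : Prop :=
  ∀ (t : ℕ) (ht : t < τ) (a : A t),
    treatProb Q ht a (histOf ht z) ≤ l * treatProb P ht a (histOf ht z) ∧
      treatProb P ht a (histOf ht z) ≤ l * treatProb Q ht a (histOf ht z)

theorem ae_treatProbComparable {P Q : ProbabilityMeasure (LongData L A τ)} {b b' : ℝ≥0}
    (hb : (Q : Measure (LongData L A τ)) ≤ (b : ℝ≥0∞) • (P : Measure (LongData L A τ)))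
    (hb' : (P : Measure (LongData L A τ)) ≤ (b' : ℝ≥0∞) • (Q : Measure (LongData L A τ))) :
    ∀ᵐ z ∂(P : Measure (LongData L A τ)), TreatProbComparable P Q (b * b' : ℝ≥0) z := by
  have h1 := (Measure.absolutelyContinuous_of_le_smul hb').ae_le (ae_treatProb_le hb hb')
  filter_upwards [h1, ae_treatProb_le hb' hb] with z hz hz' t ht a
  refine ⟨hz t ht a, ?_⟩
  rw [mul_comm b b']
  exact hz' t ht a

/-- Comparable mechanisms have the same zeros, and the regime indicator does not depend on the law.
-/
theorem Positivity.of_comparable {P Q : ProbabilityMeasure (LongData L A τ)}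
    (hpos : Positivity d P)
    (hQ : (Q : Measure (LongData L A τ)) ≪ (P : Measure (LongData L A τ))) {l : ℝ} (hl : 0 < l)
    (h : ∀ᵐ z ∂(P : Measure (LongData L A τ)), TreatProbComparable P Q l z) :
    Positivity d Q := by
  intro t ht
  refine hQ.ae_le ?_
  filter_upwards [hpos t ht, h] with z hz hc s hs hg
  have h1 := hz s hs fun u => by
    have h1 := (hc u (lt_of_lt_of_le u.isLt (Nat.succ_le_of_lt ht)) (s u)).1
    exact pos_of_mul_pos_right ((hg u).trans_le h1) hl.le
  exact pos_of_mul_pos_right (h1.trans_le (hc t ht _).2) hl.le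

/-- Each of the `k` ratios changes by at most `l` in the numerator and `l` in the denominator,
whence `l ^ 2` per factor. -/
theorem weight_le_of_comparable {P Q : ProbabilityMeasure (LongData L A τ)} {l : ℝ} (hl : 0 ≤ l)
    {z : LongData L A τ} (h : TreatProbComparable P Q l z)
    {k : ℕ} (hk : k ≤ τ) (s : Traj A k) :
    weight d Q hk s z ≤ (l ^ 2) ^ k * weight d P hk s z := by
  have hr : ratioProd Q hk s z ≤ (l ^ 2) ^ k * ratioProd P hk s z := by
    have : (l ^ 2) ^ k = ∏ _u : Fin k, l ^ 2 := by simp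
    rw [this, ratioProd, ratioProd, ← Finset.prod_mul_distrib]
    refine Finset.prod_le_prod
      (fun _ _ => div_nonneg (treatProb_nonneg ..) (treatProb_nonneg ..)) fun u _ => ?_
    obtain ⟨h1, -⟩ := h u (u.isLt.trans_le hk) (s u)
    obtain ⟨h2, h3⟩ := h u (u.isLt.trans_le hk) (trtOf (u.isLt.trans_le hk) z)
    have hA := treatProb_nonneg Q (u.isLt.trans_le hk) (trtOf (u.isLt.trans_le hk) z)
      (histOf (u.isLt.trans_le hk) z)
    have hB := treatProb_nonneg P (u.isLt.trans_le hk) (trtOf (u.isLt.trans_le hk) z)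
      (histOf (u.isLt.trans_le hk) z)
    have hC := treatProb_nonneg P (u.isLt.trans_le hk) (s u) (histOf (u.isLt.trans_le hk) z)
    -- If the denominator for `Q` vanishes, the quotient is `0` by convention and the bound is
    -- trivial.
    rcases hA.eq_or_lt with hA0 | hA0
    · rw [← hA0, div_zero]
      positivity
    · have hB0 := pos_of_mul_pos_right (hA0.trans_le h2) hl
      rw [← mul_div_assoc, div_le_div_iff₀ hA0 hB0]
      calc _ ≤ (l * treatProb P (u.isLt.trans_le hk) (s u) (histOf (u.isLt.trans_le hk) z)) *
            (l * treatProb Q (u.isLt.trans_le hk) (trtOf (u.isLt.trans_le hk) z)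
              (histOf (u.isLt.trans_le hk) z)) := by
            refine mul_le_mul h1 h3 hB (by positivity)
        _ = _ := by ring
  calc weight d Q hk s z ≤ regimeIndicator d hk s z * ((l ^ 2) ^ k * ratioProd P hk s z) :=
        mul_le_mul_of_nonneg_left hr (regimeIndicator_nonneg ..)
    _ = _ := by rw [weight]; ring

theorem abs_weight_sub_weight_le {P Q : ProbabilityMeasure (LongData L A τ)} {l : ℝ} (hl : 1 ≤ l)
    {z : LongData L A τ} (h : TreatProbComparable P Q l z) {k : ℕ} (hk : k ≤ τ) (s : Traj A k) :
    |weight d Q hk s z - weight d P hk s z| ≤ ((l ^ 2) ^ τ - 1) * weight d P hk s z := by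
  have h1 := weight_le_of_comparable (d := d) (zero_le_one.trans hl) h hk s
  have h2 := weight_le_of_comparable (d := d) (P := Q) (Q := P) (zero_le_one.trans hl)
    (fun t ht a => (h t ht a).symm) hk s
  have hl2 : 1 ≤ l ^ 2 := one_le_pow₀ hl
  have h3 : (l ^ 2) ^ k ≤ (l ^ 2) ^ τ := pow_le_pow_right₀ hl2 hk
  have h4 : 1 ≤ (l ^ 2) ^ k := one_le_pow₀ hl2
  have hP := weight_nonneg d P hk s z
  have hQ := weight_nonneg d Q hk s z
  generalize (l ^ 2) ^ k = x at *
  generalize (l ^ 2) ^ τ = y at *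
  rw [abs_le]
  constructor
  -- When the weight of `Q` is the smaller one, the difference is at most `x - 1` times the weight
  -- of `Q`, hence at most `y - 1` times that of `P`.
  · rcases le_total (weight d P hk s z) (weight d Q hk s z) with h5 | h5 <;> nlinarith
  · nlinarith

end Comparison

/-! ### Measures with density ratio close to one -/

section DensityRatio

variable {E S : Type*} [MeasurableSpace E] [MeasurableSpace S]

theorem withDensity_le_smul {P : Measure E} {r : E → ℝ≥0} {c : ℝ≥0}
    (h : ∀ᵐ z ∂P, |(r z : ℝ) - 1| ≤ c) :
    P.withDensity (fun z => (r z : ℝ≥0∞)) ≤ ((1 + c : ℝ≥0) : ℝ≥0∞) • P := by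
  rw [← withDensity_const]
  refine withDensity_mono ?_
  filter_upwards [h] with z hz
  rw [ENNReal.coe_le_coe, ← NNReal.coe_le_coe]
  push_cast
  linarith [(abs_le.1 hz).2]

theorem le_smul_withDensity {P : Measure E} {r : E → ℝ≥0} (hr : Measurable r) {c : ℝ≥0}
    (hc : c < 1) (h : ∀ᵐ z ∂P, |(r z : ℝ) - 1| ≤ c) :
    P ≤ (((1 - c)⁻¹ : ℝ≥0) : ℝ≥0∞) • P.withDensity (fun z => (r z : ℝ≥0∞)) := by
  rw [← withDensity_smul _ hr.coe_nnreal_ennreal]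
  conv_lhs => rw [← withDensity_one (μ := P)]
  refine withDensity_mono ?_
  filter_upwards [h] with z hz
  have hc' : 0 < 1 - c := tsub_pos_of_lt hc
  simp only [Pi.one_apply, Pi.smul_apply, smul_eq_mul]
  rw [← ENNReal.coe_mul, ← ENNReal.coe_one, ENNReal.coe_le_coe, inv_mul_eq_div, one_le_div hc',
    ← NNReal.coe_le_coe, NNReal.coe_sub hc.le]
  push_cast
  linarith [(abs_le.1 hz).1]

theorem ae_count_prod [SFinite (Measure.count : Measure S)] {P : Measure E} [SFinite P]
    {p : E → Prop} (h : ∀ᵐ z ∂P, p z) : ∀ᵐ y ∂((Measure.count : Measure S).prod P), p y.2 :=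
  Measure.quasiMeasurePreserving_snd.ae h

end DensityRatio

/-! ### The von Mises expansion -/

section Expansion

variable {L A : ℕ → Type*} {τ : ℕ}
variable [∀ t, MeasurableSpace (L t)] [∀ t, StandardBorelSpace (L t)] [∀ t, Nonempty (L t)]
  [∀ t, MeasurableSpace (A t)] [∀ t, DiscreteMeasurableSpace (A t)] [∀ t, Countable (A t)]
  [∀ t, Nonempty (A t)]
variable {d : Policy L A}

/-- The residual `q_{k+1}(s̄_k, A_{k+1}, H_{k+1}) - m_k(s̄_k, A_k, H_k)`. -/
def regResidual (d : Policy L A) (P : ProbabilityMeasure (LongData L A τ)) {k : ℕ} (hk : k ≤ τ)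
    (y : Traj A k × LongData L A τ) : ℝ :=
  qReg d P hk y.1 y.2 - mReg d P hk y.1 (pastOf hk y.2)

/-- Orthogonality with mixed laws: weights of `Q`, but residual and integrating measure of `P`. -/
theorem integrable_and_integral_weight_mul_regResidual
    (hd : ∀ t, Measurable (fun x : Traj A (t + 1) × Hist L A t => d t x.1 x.2))
    (P Q : ProbabilityMeasure (LongData L A τ)) {k : ℕ} (hk : k ≤ τ)
    (hint : Integrable (fun y => weight d Q hk y.1 y.2 * qReg d P hk y.1 y.2)
      (Measure.count.prod (P : Measure (LongData L A τ)))) :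
    Integrable (fun y => weight d Q hk y.1 y.2 * regResidual d P hk y)
        (Measure.count.prod (P : Measure (LongData L A τ))) ∧
      ∫ y, weight d Q hk y.1 y.2 * regResidual d P hk y
          ∂(Measure.count.prod (P : Measure (LongData L A τ))) = 0 := by
  have h := integrable_and_integral_weight_mul_mReg hd P Q hk hint
  simp only [regResidual, mul_sub]
  refine ⟨hint.sub h.1, ?_⟩
  rw [integral_sub hint h.1, h.2, sub_self]

theorem integrable_weight_mul_of_comparable
    (hd : ∀ t, Measurable (fun x : Traj A (t + 1) × Hist L A t => d t x.1 x.2))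
    {P Q : ProbabilityMeasure (LongData L A τ)} {l : ℝ} (hl : 1 ≤ l)
    (hc : ∀ᵐ z ∂(P : Measure (LongData L A τ)), TreatProbComparable P Q l z) {k : ℕ} (hk : k ≤ τ)
    {f : Traj A k × LongData L A τ → ℝ} (hf : Measurable f)
    (hint : Integrable (fun y => weight d P hk y.1 y.2 * f y)
      (Measure.count.prod (P : Measure (LongData L A τ)))) :
    Integrable (fun y => weight d Q hk y.1 y.2 * f y)
      (Measure.count.prod (P : Measure (LongData L A τ))) := by
  refine (hint.norm.const_mul ((l ^ 2) ^ k)).mono'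
    ((measurable_weight_uncurry hd Q hk).mul hf).aestronglyMeasurable ?_
  filter_upwards [ae_count_prod hc] with y hy
  rw [norm_mul, norm_mul, Real.norm_of_nonneg (weight_nonneg ..),
    Real.norm_of_nonneg (weight_nonneg ..), ← mul_assoc]
  exact mul_le_mul_of_nonneg_right (weight_le_of_comparable (zero_le_one.trans hl) hy hk y.1)
    (norm_nonneg _)

theorem count_prod_eq_withDensity {S : Type*} [MeasurableSpace S] [Countable S]
    {P Q : ProbabilityMeasure (LongData L A τ)} {r : LongData L A τ → ℝ≥0} (hr : Measurable r)
    (hQ : (Q : Measure (LongData L A τ)) =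
      (P : Measure (LongData L A τ)).withDensity fun z => (r z : ℝ≥0∞)) :
    (Measure.count : Measure S).prod (Q : Measure (LongData L A τ)) =
      (Measure.count.prod (P : Measure (LongData L A τ))).withDensity
        fun y => (r y.2 : ℝ≥0∞) := by
  rw [hQ, prod_withDensity_right hr.coe_nnreal_ennreal]

theorem integrable_count_prod_of_withDensity {S : Type*} [MeasurableSpace S] [Countable S]
    {P Q : ProbabilityMeasure (LongData L A τ)} {r : LongData L A τ → ℝ≥0} (hr : Measurable r)
    (hQ : (Q : Measure (LongData L A τ)) =
      (P : Measure (LongData L A τ)).withDensity fun z => (r z : ℝ≥0∞)) {c : ℝ}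
    (hc : ∀ᵐ z ∂(P : Measure (LongData L A τ)), |(r z : ℝ) - 1| ≤ c)
    {f : S × LongData L A τ → ℝ}
    (hf : Integrable f (Measure.count.prod (P : Measure (LongData L A τ)))) :
    Integrable f (Measure.count.prod (Q : Measure (LongData L A τ))) := by
  have hr2 : Measurable fun y : S × LongData L A τ => r y.2 := hr.comp measurable_snd
  rw [count_prod_eq_withDensity hr hQ, integrable_withDensity_iff_integrable_smul hr2]
  refine Integrable.bdd_mul (c := 1 + c) hf hr2.coe_nnreal_real.aestronglyMeasurable ?_
  filter_upwards [ae_count_prod hc] with y hy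
  rw [Real.norm_of_nonneg (NNReal.coe_nonneg _)]
  linarith [(abs_le.1 hy).2]

/-- The difference is the integral of `(r - 1)(W^Q - W^P)` times the residual, a product of two
small factors: `c` bounds the first, and `((l ^ 2) ^ τ - 1) W^P` the second. -/
theorem abs_integral_regResidual_sub_le
    (hd : ∀ t, Measurable (fun x : Traj A (t + 1) × Hist L A t => d t x.1 x.2))
    {P Q : ProbabilityMeasure (LongData L A τ)} {r : LongData L A τ → ℝ≥0} (hr : Measurable r)
    (hQ : (Q : Measure (LongData L A τ)) =
      (P : Measure (LongData L A τ)).withDensity fun z => (r z : ℝ≥0∞)) {c l : ℝ} (hl : 1 ≤ l)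
    (hc : ∀ᵐ z ∂(P : Measure (LongData L A τ)), |(r z : ℝ) - 1| ≤ c)
    (hcomp : ∀ᵐ z ∂(P : Measure (LongData L A τ)), TreatProbComparable P Q l z) {k : ℕ}
    (hk : k ≤ τ)
    (hint : Integrable (fun y => weight d P hk y.1 y.2 * qReg d P hk y.1 y.2)
      (Measure.count.prod (P : Measure (LongData L A τ)))) :
    |∫ y, regResidual d P hk y ∂(weightMeasure d Q hk) -
        ∫ z, ((r z : ℝ) - 1) * ∑' s, weight d P hk s z * regResidual d P hk (s, z)
          ∂(P : Measure (LongData L A τ))| ≤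
      c * ((l ^ 2) ^ τ - 1) * ∫ y, |weight d P hk y.1 y.2 * regResidual d P hk y|
        ∂(Measure.count.prod (P : Measure (LongData L A τ))) := by
  set B := (Measure.count : Measure (Traj A k)).prod (P : Measure (LongData L A τ)) with hB
  obtain ⟨hP, -⟩ := integrable_and_integral_weight_mul_regResidual hd P P hk hint
  obtain ⟨hQi, hQ0⟩ := integrable_and_integral_weight_mul_regResidual hd P Q hk
    (integrable_weight_mul_of_comparable hd hl hcomp hk (measurable_qReg_uncurry hd P hk) hint)
  have hr2 : Measurable fun y : Traj A k × LongData L A τ => r y.2 := hr.comp measurable_snd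
  have hbd : ∀ᵐ y ∂B, ‖(r y.2 : ℝ) - 1‖ ≤ c := ae_count_prod hc
  have hrm : AEStronglyMeasurable (fun y : Traj A k × LongData L A τ => (r y.2 : ℝ) - 1) B :=
    (hr2.coe_nnreal_real.sub_const 1).aestronglyMeasurable
  have h1 : Integrable (fun y => ((r y.2 : ℝ) - 1) * (weight d P hk y.1 y.2 * regResidual d P hk y))
    B := hP.bdd_mul hrm hbd
  have h2 : Integrable (fun y => ((r y.2 : ℝ) - 1) * (weight d Q hk y.1 y.2 * regResidual d P hk y))
    B := hQi.bdd_mul hrm hbd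
  -- Subtracting the vanishing `P`-integral of the residual with the weights of `Q` replaces the
  -- density `r` by `r - 1`.
  have e1 : ∫ y, regResidual d P hk y ∂(weightMeasure d Q hk) =
      ∫ y, ((r y.2 : ℝ) - 1) * (weight d Q hk y.1 y.2 * regResidual d P hk y) ∂B := by
    rw [integral_weightMeasure hd, count_prod_eq_withDensity hr hQ,
      integral_withDensity_eq_integral_smul hr2, ← hB, ← sub_zero (∫ y, r y.2 • _ ∂B), ← hQ0,
      ← integral_sub _ hQi]
    · refine integral_congr_ae (ae_of_all _ fun y => ?_)
      simp only [NNReal.smul_def, smul_eq_mul]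
      ring
    · refine (h2.add hQi).congr (ae_of_all _ fun y => ?_)
      simp only [NNReal.smul_def, smul_eq_mul, Pi.add_apply]
      ring
  have e2 : ∫ z, ((r z : ℝ) - 1) * ∑' s, weight d P hk s z * regResidual d P hk (s, z)
        ∂(P : Measure (LongData L A τ)) =
      ∫ y, ((r y.2 : ℝ) - 1) * (weight d P hk y.1 y.2 * regResidual d P hk y) ∂B := by
    have h := (integrable_tsum_of_count_prod (P : Measure (LongData L A τ))
      (F := fun s z => ((r z : ℝ) - 1) * (weight d P hk s z * regResidual d P hk (s, z))) h1).2
    simp only [tsum_mul_left] at h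
    exact h
  rw [e1, e2, ← integral_sub h2 h1, ← integral_const_mul]
  refine abs_integral_le_integral_abs.trans
    (integral_mono_ae (h2.sub h1).abs (hP.abs.const_mul _) ?_)
  filter_upwards [hbd, ae_count_prod hcomp] with y hy hy'
  have hw := abs_weight_sub_weight_le (d := d) hl hy' hk y.1
  have hc0 : 0 ≤ c := (norm_nonneg _).trans hy
  calc |((r y.2 : ℝ) - 1) * (weight d Q hk y.1 y.2 * regResidual d P hk y) -
          ((r y.2 : ℝ) - 1) * (weight d P hk y.1 y.2 * regResidual d P hk y)|
      = ‖(r y.2 : ℝ) - 1‖ * (|weight d Q hk y.1 y.2 - weight d P hk y.1 y.2| *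
          |regResidual d P hk y|) := by
        rw [Real.norm_eq_abs, ← abs_mul, ← abs_mul]; congr 1; ring
    _ ≤ c * ((((l ^ 2) ^ τ - 1) * weight d P hk y.1 y.2) * |regResidual d P hk y|) := by
        gcongr
    _ = _ := by rw [abs_mul, abs_of_nonneg (weight_nonneg ..)]; ring

/-- The factor by which the treatment mechanisms may differ when the densities differ by a factor
between `1 - c` and `1 + c`. -/
def mechanismFactor (c : ℝ≥0) : ℝ := ((1 + c) * (1 - c)⁻¹ : ℝ≥0)

theorem one_le_mechanismFactor {c : ℝ≥0} (hc : c < 1) : 1 ≤ mechanismFactor c := by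
  have hc' : 0 < 1 - c := tsub_pos_of_lt hc
  rw [mechanismFactor, ← NNReal.coe_one, NNReal.coe_le_coe, ← div_eq_mul_inv, one_le_div hc']
  exact tsub_le_self.trans le_self_add

/-- The von Mises expansion of `theta`, with gradient `phiOne` and explicit remainder. -/
theorem exists_abs_theta_sub_le
    (hd : ∀ t, Measurable (fun x : Traj A (t + 1) × Hist L A t => d t x.1 x.2))
    {P : ProbabilityMeasure (LongData L A τ)} (hpos : Positivity d P)
    (hfin : FiniteInterventionMean d P) :
    ∃ K : ℝ, ∀ (Q : ProbabilityMeasure (LongData L A τ)) (r : LongData L A τ → ℝ≥0) (c : ℝ≥0),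
      Measurable r → c < 1 →
      (Q : Measure (LongData L A τ)) =
        (P : Measure (LongData L A τ)).withDensity (fun z => (r z : ℝ≥0∞)) →
      (∀ᵐ z ∂(P : Measure (LongData L A τ)), |(r z : ℝ) - 1| ≤ c) →
      |theta d Q - theta d P - ∫ z, ((r z : ℝ) - 1) * phiOne d P z
          ∂(P : Measure (LongData L A τ))| ≤
        c * ((mechanismFactor c ^ 2) ^ τ - 1) * K := by
  have hq : ∀ (k : ℕ) (hk : k ≤ τ), Integrable
      (fun y => weight d P hk y.1 y.2 * qReg d P hk y.1 y.2)
      (Measure.count.prod (P : Measure (LongData L A τ))) := fun k hk =>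
    (integrable_weightMeasure_iff hd P hk).1
      (integrable_qReg_of_integrable_outcome hd hpos (hfin.integrable_outcome hd) hk)
  have hq0 := (integrable_and_integral_weightMeasure_zero hd P (F := qReg d P (Nat.zero_le τ))
    (integrable_qReg_of_integrable_outcome hd hpos (hfin.integrable_outcome hd) _)).1
  -- The constant is the sum of the `L¹` norms of the weighted residuals under `P`, so it does not
  -- depend on `Q`.
  refine ⟨∑ j : Fin τ, ∫ y, |weight d P (Nat.succ_le_of_lt j.isLt) y.1 y.2 *
    regResidual d P (Nat.succ_le_of_lt j.isLt) y|
      ∂(Measure.count.prod (P : Measure (LongData L A τ))), fun Q r c hr hc1 hQ hc => ?_⟩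
  have hb := withDensity_le_smul hc
  have hb' := le_smul_withDensity hr hc1 hc
  rw [← hQ] at hb hb'
  have hcomp : ∀ᵐ z ∂(P : Measure (LongData L A τ)),
      TreatProbComparable P Q (mechanismFactor c) z := ae_treatProbComparable hb hb'
  have hl := one_le_mechanismFactor hc1
  have hposQ := hpos.of_comparable (Measure.absolutelyContinuous_of_le_smul hb)
    (zero_lt_one.trans_le hl) hcomp
  have hqQ : ∀ (k : ℕ) (hk : k ≤ τ),
      Integrable (fun y => qReg d P hk y.1 y.2) (weightMeasure d Q hk) := fun k hk =>
    (integrable_weightMeasure_iff hd Q hk).2 (integrable_count_prod_of_withDensity hr hQ hc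
      (integrable_weight_mul_of_comparable hd hl hcomp hk (measurable_qReg_uncurry hd P hk)
        (hq k hk)))
  have hrm : AEStronglyMeasurable (fun z => (r z : ℝ) - 1) (P : Measure (LongData L A τ)) :=
    (hr.coe_nnreal_real.sub_const 1).aestronglyMeasurable
  have hterm : ∀ j : Fin τ, Integrable (fun z => ((r z : ℝ) - 1) *
      ∑' s, weight d P (Nat.succ_le_of_lt j.isLt) s z *
        regResidual d P (Nat.succ_le_of_lt j.isLt) (s, z)) (P : Measure (LongData L A τ)) := fun j =>
    ((integrable_tsum_of_count_prod (P : Measure (LongData L A τ))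
      (F := fun s z => weight d P (Nat.succ_le_of_lt j.isLt) s z *
        regResidual d P (Nat.succ_le_of_lt j.isLt) (s, z))
      (integrable_and_integral_weight_mul_regResidual hd P P _ (hq _ _)).1).1).bdd_mul hrm hc
  have hphi : ∫ z, ((r z : ℝ) - 1) * phiOne d P z ∂(P : Measure (LongData L A τ)) =
      ∑ j : Fin τ, ∫ z, ((r z : ℝ) - 1) * ∑' s, weight d P (Nat.succ_le_of_lt j.isLt) s z *
        regResidual d P (Nat.succ_le_of_lt j.isLt) (s, z) ∂(P : Measure (LongData L A τ)) +
      ∫ z, ((r z : ℝ) - 1) * qReg d P (Nat.zero_le τ) (fun u => u.elim0) z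
        ∂(P : Measure (LongData L A τ)) := by
    rw [← integral_finsetSum _ fun j _ => hterm j,
      ← integral_add (integrable_finsetSum _ fun j _ => hterm j) (hq0.bdd_mul hrm hc)]
    refine integral_congr_ae (ae_of_all _ fun z => ?_)
    simp only [phiOne, mul_add, Finset.mul_sum]
    rfl
  -- The term with `q_1` is linear in the law and contributes nothing to the remainder.
  have hzero : ∫ z, qReg d P (Nat.zero_le τ) (fun u => u.elim0) z ∂(Q : Measure (LongData L A τ)) -
      theta d P = ∫ z, ((r z : ℝ) - 1) * qReg d P (Nat.zero_le τ) (fun u => u.elim0) z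
        ∂(P : Measure (LongData L A τ)) := by
    have hrq := (hq0.bdd_mul hrm hc).add hq0
    rw [theta, hQ, integral_withDensity_eq_integral_smul hr, ← integral_sub _ hq0]
    · refine integral_congr_ae (ae_of_all _ fun z => ?_)
      simp only [NNReal.smul_def, smul_eq_mul]
      ring
    · refine hrq.congr (ae_of_all _ fun z => ?_)
      simp only [NNReal.smul_def, smul_eq_mul, Pi.add_apply]
      ring
  have hsum := theta_eq_sum_add_integral hd hposQ P hqQ
  rw [hphi, ← hzero, hsum, Finset.mul_sum]
  rw [show ∀ a b x t : ℝ, a + x - t - (b + (x - t)) = a - b from fun a b x t => by ring,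
    ← Finset.sum_sub_distrib]
  exact (Finset.abs_sum_le_sum_abs _ _).trans (Finset.sum_le_sum fun j _ =>
    abs_integral_regResidual_sub_le hd hr hQ hl hc hcomp _ (hq _ _))

/-- Every residual term has mean zero by orthogonality, so only `q_1` contributes to the mean. -/
theorem integrable_and_integral_phiOne
    (hd : ∀ t, Measurable (fun x : Traj A (t + 1) × Hist L A t => d t x.1 x.2))
    {P : ProbabilityMeasure (LongData L A τ)} (hpos : Positivity d P)
    (hfin : FiniteInterventionMean d P) :
    Integrable (phiOne d P) (P : Measure (LongData L A τ)) ∧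
      ∫ z, phiOne d P z ∂(P : Measure (LongData L A τ)) = theta d P := by
  have hq0 := (integrable_and_integral_weightMeasure_zero hd P (F := qReg d P (Nat.zero_le τ))
    (integrable_qReg_of_integrable_outcome hd hpos (hfin.integrable_outcome hd) _)).1
  have hterm : ∀ j : Fin τ, Integrable (fun z =>
      ∑' s, weight d P (Nat.succ_le_of_lt j.isLt) s z *
        regResidual d P (Nat.succ_le_of_lt j.isLt) (s, z)) (P : Measure (LongData L A τ)) ∧
      ∫ z, ∑' s, weight d P (Nat.succ_le_of_lt j.isLt) s z *
        regResidual d P (Nat.succ_le_of_lt j.isLt) (s, z) ∂(P : Measure (LongData L A τ)) = 0 :=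
    fun j => by
      have hr := integrable_and_integral_weight_mul_regResidual hd P P (Nat.succ_le_of_lt j.isLt)
        ((integrable_weightMeasure_iff hd P _).1
          (integrable_qReg_of_integrable_outcome hd hpos (hfin.integrable_outcome hd) _))
      have h := integrable_tsum_of_count_prod (P : Measure (LongData L A τ))
        (F := fun s z => weight d P (Nat.succ_le_of_lt j.isLt) s z *
          regResidual d P (Nat.succ_le_of_lt j.isLt) (s, z)) hr.1
      exact ⟨h.1, h.2.trans hr.2⟩
  have hs := integrable_finsetSum Finset.univ fun j _ => (hterm j).1
  refine ⟨hs.add hq0, ?_⟩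
  refine (integral_add hs hq0).trans ?_
  rw [integral_finsetSum _ fun j _ => (hterm j).1, Finset.sum_eq_zero fun j _ => (hterm j).2,
    zero_add, theta]

end Expansion

/-! ### Smooth submodels and the tangent space -/

section Semiparametric

variable {Z : Type*} [TopologicalSpace Z] [MeasurableSpace Z] {ν : Measure Z}
  {P : ProbabilityMeasure Z}

/-- The path has density `p (1 + ε h)`: the mean-zero condition keeps its total mass `1`,
boundedness of `h` keeps it positive relative to `p` for small `ε`, and continuity of `h` keeps it
in the model. -/
theorem exists_isSmoothSubmodel_of_boundedContinuous [OpensMeasurableSpace Z]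
    (hP : P ∈ nonparametricModel ν) (h : BoundedContinuousFunction Z ℝ)
    (h0 : ∫ z, h z ∂(P : Measure Z) = 0) :
    ∃ Q : ℝ → ProbabilityMeasure Z, IsSmoothSubmodel ν P Q h := by
  obtain ⟨p, hpc, hp⟩ := hP
  let q : ℝ → Z → ℝ≥0 := fun ε z => p z * Real.toNNReal (1 + ε * h z)
  have hle : ∀ ε z, |ε * h z| ≤ |ε| * ‖h‖ := fun ε z => by
    rw [abs_mul]
    exact mul_le_mul_of_nonneg_left (h.norm_coe_le_norm z) (abs_nonneg _)
  have hpos : ∀ ε, |ε| * ‖h‖ < 1 → ∀ z, 0 < 1 + ε * h z := fun ε hε z => by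
    linarith [(abs_le.1 (hle ε z)).1]
  have hint : Integrable h (P : Measure Z) := h.integrable _
  have hq : ∀ ε, ν.withDensity (fun z => (q ε z : ℝ≥0∞)) =
      (P : Measure Z).withDensity fun z => (Real.toNNReal (1 + ε * h z) : ℝ≥0∞) := fun ε => by
    have hm : Measurable fun z => (Real.toNNReal (1 + ε * h z) : ℝ≥0∞) :=
      ((h.continuous.measurable.const_mul ε).const_add 1).real_toNNReal.coe_nnreal_ennreal
    rw [hp, ← withDensity_mul _ hpc.measurable.coe_nnreal_ennreal hm]
    congr 1
  have hprob : ∀ ε, |ε| * ‖h‖ < 1 →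
      IsProbabilityMeasure (ν.withDensity (fun z => (q ε z : ℝ≥0∞))) := fun ε hε => by
    refine ⟨?_⟩
    rw [hq, withDensity_apply _ MeasurableSet.univ, Measure.restrict_univ]
    change ∫⁻ z, ENNReal.ofReal (1 + ε * h z) ∂(P : Measure Z) = 1
    have hi : Integrable (fun z => 1 + ε * h z) (P : Measure Z) :=
      (integrable_const _).add (hint.const_mul ε)
    rw [← ofReal_integral_eq_lintegral_ofReal hi (ae_of_all _ fun z => (hpos ε hε z).le),
      integral_add (integrable_const _) (hint.const_mul ε),
      integral_const_mul, h0]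
    simp
  have hev : ∀ᶠ ε in 𝓝 (0 : ℝ), |ε| * ‖h‖ < 1 := by
    have : Tendsto (fun ε : ℝ => |ε| * ‖h‖) (𝓝 0) (𝓝 (|0| * ‖h‖)) :=
      Continuous.tendsto (by fun_prop) 0
    rw [abs_zero, zero_mul] at this
    exact this.eventually (gt_mem_nhds one_pos)
  -- For large `ε`, where `1 + ε h` might be negative, the path is set to `P`; only `ε` near `0`
  -- matters.
  have hQ : ∀ ε, ∃ Q : ProbabilityMeasure Z, |ε| * ‖h‖ < 1 →
      (Q : Measure Z) = ν.withDensity (fun z => (q ε z : ℝ≥0∞)) := fun ε => by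
    by_cases hε : |ε| * ‖h‖ < 1
    · exact ⟨⟨_, hprob ε hε⟩, fun _ => rfl⟩
    · exact ⟨P, fun h' => absurd h' hε⟩
  choose Q hQ using hQ
  refine ⟨Q, q, ?_, ?_, ?_, ‖h‖, ?_⟩
  · refine Subtype.ext ?_
    change (Q 0 : Measure Z) = P
    rw [hQ 0 (by simp), hq]
    simp
  · filter_upwards [hev] with ε hε
    exact ⟨hpc.mul (continuous_real_toNNReal.comp (by fun_prop)), hQ ε hε⟩
  -- The logarithmic derivative is needed only where `p` is nonzero, which holds `P`-almost
  -- everywhere.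
  · rw [hp, ae_withDensity_iff hpc.measurable.coe_nnreal_ennreal]
    refine ae_of_all _ fun z hz => ?_
    have hz' : (p z : ℝ) ≠ 0 := by simpa using hz
    have h1 : HasDerivAt (fun ε : ℝ => (p z : ℝ) * (1 + ε * h z)) (p z * h z) 0 := by
      simpa using (((hasDerivAt_id (0 : ℝ)).mul_const (h z)).const_add 1).const_mul (p z : ℝ)
    have h2 := h1.log (by simpa using hz')
    have h3 : (p z : ℝ) * h z / (p z * (1 + 0 * h z)) = h z := by
      rw [zero_mul, add_zero, mul_one, mul_div_cancel_left₀ _ hz']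
    rw [h3] at h2
    refine h2.congr_of_eventuallyEq ?_
    filter_upwards [hev] with ε hε
    simp [q, Real.coe_toNNReal _ (hpos ε hε z).le]
  · filter_upwards [hev] with ε hε
    refine ae_of_all _ fun z => ?_
    simp only [q, NNReal.coe_mul, Real.coe_toNNReal _ (hpos ε hε z).le, zero_mul, add_zero,
      Real.toNNReal_one, mul_one]
    rw [show (p z : ℝ) * (1 + ε * h z) - p z = (ε * h z) * p z by ring, abs_mul,
      abs_of_nonneg (NNReal.coe_nonneg (p z)), mul_comm ‖h‖]
    exact mul_le_mul_of_nonneg_right (hle ε z) (NNReal.coe_nonneg _)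

/-- Approximate by a bounded continuous `g` in `L²` and subtract its mean `c`. As `f` has mean zero,
`|c|` is at most the `L¹` distance of `f` and `g`, so centring at most doubles the error. -/
theorem mem_tangentSpace_of_integral_eq_zero [BorelSpace Z] [NormalSpace Z]
    [(P : Measure Z).WeaklyRegular] (hP : P ∈ nonparametricModel ν) {f : Z → ℝ}
    (hf : MemLp f 2 (P : Measure Z)) (h0 : ∫ z, f z ∂(P : Measure Z) = 0) :
    hf.toLp f ∈ tangentSpace ν P := by
  rw [tangentSpace, ← SetLike.mem_coe, Submodule.topologicalClosure_coe, Metric.mem_closure_iff]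
  intro ε hε
  -- The approximation and the centring cost `ε / 3` each, which leaves a strict inequality.
  obtain ⟨g, hg, hgm⟩ := hf.exists_boundedContinuous_eLpNorm_sub_le (by norm_num)
    (ε := ENNReal.ofReal (ε / 3)) (by simpa using by positivity)
  set c : ℝ := ∫ z, g z ∂(P : Measure Z) with hc
  have hgi : Integrable g (P : Measure Z) := g.integrable _
  let h : BoundedContinuousFunction Z ℝ := g - BoundedContinuousFunction.const Z c
  have hh0 : ∫ z, h z ∂(P : Measure Z) = 0 := by
    have : ∫ z, h z ∂(P : Measure Z) = ∫ z, (g z - c) ∂(P : Measure Z) := rfl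
    rw [this, integral_sub hgi (integrable_const c)]
    simp [hc]
  have hhm : MemLp h 2 (P : Measure Z) := hgm.sub (memLp_const c)
  obtain ⟨Q, hQ⟩ := exists_isSmoothSubmodel_of_boundedContinuous hP h hh0
  refine ⟨hhm.toLp h, Submodule.subset_span ⟨Q, h, hQ, hhm.coeFn_toLp⟩, ?_⟩
  have hcle : ‖c‖ₑ ≤ ENNReal.ofReal (ε / 3) := by
    have h1 : c = -∫ z, (f - ⇑g) z ∂(P : Measure Z) := by
      simp only [Pi.sub_apply]
      rw [integral_sub (hf.integrable one_le_two) hgi, h0, zero_sub, neg_neg]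
    rw [h1, enorm_neg]
    calc _ ≤ ∫⁻ z, ‖(f - ⇑g) z‖ₑ ∂(P : Measure Z) := enorm_integral_le_lintegral_enorm _
      _ = eLpNorm (f - ⇑g) 1 (P : Measure Z) := eLpNorm_one_eq_lintegral_enorm.symm
      _ ≤ eLpNorm (f - ⇑g) 2 (P : Measure Z) :=
        eLpNorm_le_eLpNorm_of_exponent_le one_le_two (hf.sub hgm).aestronglyMeasurable
      _ ≤ _ := hg
  rw [← edist_lt_ofReal, Lp.edist_toLp_toLp]
  have hsub : f - ⇑h = (f - ⇑g) + fun _ => c := by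
    funext z
    simp only [Pi.sub_apply, Pi.add_apply, h, BoundedContinuousFunction.coe_sub,
      BoundedContinuousFunction.const_apply]
    ring
  rw [hsub]
  calc _ ≤ eLpNorm (f - ⇑g) 2 (P : Measure Z) + eLpNorm (fun _ => c) 2 (P : Measure Z) :=
        eLpNorm_add_le (hf.sub hgm).aestronglyMeasurable aestronglyMeasurable_const one_le_two
    _ ≤ ENNReal.ofReal (ε / 3) + ENNReal.ofReal (ε / 3) := by
        refine add_le_add hg ?_
        rw [eLpNorm_const _ two_ne_zero (NeZero.ne _)]
        simpa using hcle
    _ = ENNReal.ofReal (ε / 3 + ε / 3) := (ENNReal.ofReal_add (by positivity) (by positivity)).symm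
    _ < ENNReal.ofReal ε := (ENNReal.ofReal_lt_ofReal_iff hε).2 (by linarith)

/-- Along a smooth submodel the density ratios with respect to `P` are uniformly close to `1`, and
their difference quotients converge to the score along every sequence. -/
theorem IsSmoothSubmodel.exists_densityRatio [OpensMeasurableSpace Z]
    {Q : ℝ → ProbabilityMeasure Z} {s : Z → ℝ} (hs : IsSmoothSubmodel ν P Q s) :
    ∃ (r : ℝ → Z → ℝ≥0) (C : ℝ≥0),
      (∀ᶠ ε in 𝓝 (0 : ℝ), Measurable (r ε) ∧
        (Q ε : Measure Z) = (P : Measure Z).withDensity (fun z => (r ε z : ℝ≥0∞)) ∧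
        ∀ᵐ z ∂(P : Measure Z), |(r ε z : ℝ) - 1| ≤ (C * ‖ε‖₊ : ℝ≥0)) ∧
      ∀ u : ℕ → ℝ, Tendsto u atTop (𝓝[≠] 0) →
        ∀ᵐ z ∂(P : Measure Z),
          Tendsto (fun n => (u n)⁻¹ * ((r (u n) z : ℝ) - 1)) atTop (𝓝 (s z)) := by
  obtain ⟨p, hQ0, hp, hderiv, C, hC⟩ := hs
  obtain ⟨hp0c, hp0⟩ := hp.self_of_nhds
  rw [hQ0] at hp0
  have hp0m := hp0c.measurable.coe_nnreal_ennreal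
  have hne : ∀ᵐ z ∂(P : Measure Z), (p 0 z : ℝ) ≠ 0 := by
    rw [hp0, ae_withDensity_iff hp0m]
    exact ae_of_all _ fun z hz => by simpa using hz
  have hbd : ∀ ε : ℝ, (∀ᵐ z ∂ν, |(p ε z : ℝ) - (p 0 z : ℝ)| ≤ C * |ε| * (p 0 z : ℝ)) →
      ∀ᵐ z ∂(P : Measure Z), |((p ε z / p 0 z : ℝ≥0) : ℝ) - 1| ≤ (‖C‖₊ * ‖ε‖₊ : ℝ≥0) := by
    intro ε h
    have h' : ∀ᵐ z ∂(P : Measure Z), |(p ε z : ℝ) - (p 0 z : ℝ)| ≤ C * |ε| * (p 0 z : ℝ) := by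
      rw [hp0]
      exact (withDensity_absolutelyContinuous _ _).ae_le h
    filter_upwards [hne, h'] with z hz hz'
    have hz0 : 0 < (p 0 z : ℝ) := (NNReal.coe_nonneg _).lt_of_ne' hz
    rw [NNReal.coe_div, div_sub_one hz, abs_div, abs_of_pos hz0, div_le_iff₀ hz0]
    refine hz'.trans (mul_le_mul_of_nonneg_right ?_ hz0.le)
    simpa using mul_le_mul_of_nonneg_right (le_abs_self C) (abs_nonneg ε)
  refine ⟨fun ε z => p ε z / p 0 z, ‖C‖₊, ?_, fun u hu => ?_⟩
  · filter_upwards [hp, hC] with ε hpε hCε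
    have hrm : Measurable fun z => p ε z / p 0 z := hpε.1.measurable.div hp0c.measurable
    refine ⟨hrm, ?_, hbd ε hCε⟩
    rw [hpε.2, hp0, ← withDensity_mul _ hp0m hrm.coe_nnreal_ennreal]
    refine withDensity_congr_ae ?_
    filter_upwards [hCε] with z hz
    rw [Pi.mul_apply, ← ENNReal.coe_mul]
    -- Where the base density vanishes, the relative bound makes the perturbed density vanish too,
    -- so nothing of `Q ε` is lost by the convention `0 / 0 = 0`.
    by_cases h0 : p 0 z = 0
    · have h' : (p ε z : ℝ) ≤ 0 := by simpa [h0] using hz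
      have : p ε z = 0 := NNReal.coe_eq_zero.1 (h'.antisymm (NNReal.coe_nonneg _))
      simp [h0, this]
    · rw [mul_div_cancel₀ _ h0]
  · have hu0 : Tendsto u atTop (𝓝 0) := hu.mono_right nhdsWithin_le_nhds
    have hev := hu0.eventually hC
    -- The exceptional null set of the bound depends on `ε`; along a sequence only countably many of
    -- them occur. The implication covers the indices at which the bound is not available.
    have hall : ∀ᵐ z ∂(P : Measure Z), ∀ n,
        (∀ᵐ z ∂ν, |(p (u n) z : ℝ) - (p 0 z : ℝ)| ≤ C * |u n| * (p 0 z : ℝ)) →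
          |((p (u n) z / p 0 z : ℝ≥0) : ℝ) - 1| ≤ (‖C‖₊ * ‖u n‖₊ : ℝ≥0) := by
      rw [ae_all_iff]
      intro n
      by_cases h : ∀ᵐ z ∂ν, |(p (u n) z : ℝ) - (p 0 z : ℝ)| ≤ C * |u n| * (p 0 z : ℝ)
      · filter_upwards [hbd (u n) h] with z hz _ using hz
      · exact ae_of_all _ fun z h' => absurd h' h
    have hsmall : ∀ᶠ n in atTop, ((‖C‖₊ * ‖u n‖₊ : ℝ≥0) : ℝ) < 1 := by
      have : Tendsto (fun n => ‖C‖ * ‖u n‖) atTop (𝓝 (‖C‖ * ‖(0 : ℝ)‖)) :=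
        hu0.norm.const_mul _
      rw [norm_zero, mul_zero] at this
      exact this.eventually (gt_mem_nhds one_pos)
    filter_upwards [hne, hderiv, hall] with z hz hdz hallz
    have hz0 : 0 < (p 0 z : ℝ) := (NNReal.coe_nonneg _).lt_of_ne' hz
    -- Exponentiating the logarithm recovers the density only where it is positive. At the points of
    -- the sequence this follows from the relative bound once it is below `1`.
    have hexp := hdz.exp
    rw [Real.exp_log hz0] at hexp
    have hlim := ((hasDerivAt_iff_tendsto_slope_zero.1 hexp).comp hu).const_mul (p 0 z : ℝ)⁻¹
    rw [inv_mul_cancel_left₀ hz] at hlim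
    refine hlim.congr' ?_
    filter_upwards [hev, hsmall] with n hn hn'
    have hr := (abs_le.1 (hallz n hn)).1
    have hpn : 0 < (p (u n) z : ℝ) := by
      have : 0 < ((p (u n) z / p 0 z : ℝ≥0) : ℝ) := by linarith
      rw [NNReal.coe_div] at this
      exact (div_pos_iff_of_pos_right hz0).1 this
    simp only [Function.comp_apply, zero_add, smul_eq_mul, Real.exp_log hz0, Real.exp_log hpn,
      NNReal.coe_div]
    field_simp

end Semiparametric

/-! ### Differentiability of the parameter along smooth submodels -/

theorem continuousAt_mechanismFactor_zero : ContinuousAt mechanismFactor 0 := by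
  refine NNReal.continuous_coe.continuousAt.comp ?_
  refine ContinuousAt.mul (by fun_prop) (ContinuousAt.inv₀ ?_ (by simp))
  exact continuousAt_const.sub continuousAt_id

section Derivative

variable {L A : ℕ → Type*} {τ : ℕ}
variable [∀ t, MeasurableSpace (L t)] [∀ t, StandardBorelSpace (L t)] [∀ t, Nonempty (L t)]
  [∀ t, MeasurableSpace (A t)] [∀ t, DiscreteMeasurableSpace (A t)] [∀ t, Countable (A t)]
  [∀ t, Nonempty (A t)]
variable {d : Policy L A}

/-- The linear term of the expansion converges by dominated convergence, and the remainder divided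
by `ε` tends to zero. Integrability of `phiOne` is enough here, since the difference quotients of
the density ratio are bounded. -/
theorem hasDerivAt_theta [TopologicalSpace (LongData L A τ)]
    [OpensMeasurableSpace (LongData L A τ)]
    (hd : ∀ t, Measurable (fun x : Traj A (t + 1) × Hist L A t => d t x.1 x.2))
    {ν : Measure (LongData L A τ)} {P : ProbabilityMeasure (LongData L A τ)}
    (hpos : Positivity d P) (hfin : FiniteInterventionMean d P)
    {Q : ℝ → ProbabilityMeasure (LongData L A τ)} {s : LongData L A τ → ℝ}
    (hs : IsSmoothSubmodel ν P Q s) :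
    HasDerivAt (fun ε => theta d (Q ε))
      (∫ z, (phiOne d P z - theta d P) * s z ∂(P : Measure (LongData L A τ))) 0 := by
  obtain ⟨r, C, hr, hlim⟩ := hs.exists_densityRatio
  have hQ0 : Q 0 = P := by
    obtain ⟨_, h, -⟩ := hs
    exact h
  obtain ⟨K, hK⟩ := exists_abs_theta_sub_le hd hpos hfin
  have hphi := (integrable_and_integral_phiOne hd hpos hfin).1
  have hphi' := hphi.sub (integrable_const (theta d P))
  rw [hasDerivAt_iff_tendsto_slope_zero]
  -- Sequences, because convergence to the score holds almost everywhere along each sequence, with a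
  -- null set depending on it.
  refine tendsto_of_seq_tendsto fun u hu => ?_
  simp only [zero_add, hQ0, smul_eq_mul]
  have hu0 : Tendsto u atTop (𝓝 0) := hu.mono_right nhdsWithin_le_nhds
  have hune : ∀ᶠ n in atTop, u n ≠ 0 := hu.eventually self_mem_nhdsWithin
  have hc0 : Tendsto (fun n => C * ‖u n‖₊) atTop (𝓝 0) := by
    have := hu0.nnnorm.const_mul C
    rwa [nnnorm_zero, mul_zero] at this
  have hsmall : ∀ᶠ n in atTop, C * ‖u n‖₊ < 1 := hc0.eventually (gt_mem_nhds one_pos)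
  have hmain : Tendsto (fun n => ∫ z, ((u n)⁻¹ * ((r (u n) z : ℝ) - 1)) *
      (phiOne d P z - theta d P) ∂(P : Measure (LongData L A τ))) atTop
      (𝓝 (∫ z, (phiOne d P z - theta d P) * s z ∂(P : Measure (LongData L A τ)))) := by
    refine tendsto_integral_filter_of_dominated_convergence
      (fun z => C * ‖phiOne d P z - theta d P‖) ?_ ?_ (hphi'.norm.const_mul _) ?_
    · filter_upwards [hu0.eventually hr] with n hn
      exact ((hn.1.coe_nnreal_real.sub_const 1).const_mul _).aestronglyMeasurable.mul
        hphi'.aestronglyMeasurable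
    · filter_upwards [hu0.eventually hr, hune] with n hn hn0
      filter_upwards [hn.2.2] with z hz
      rw [norm_mul]
      refine mul_le_mul_of_nonneg_right ?_ (norm_nonneg _)
      rw [norm_mul, norm_inv, inv_mul_le_iff₀ (norm_pos_iff.2 hn0), mul_comm]
      exact hz
    · filter_upwards [hlim u hu] with z hz
      rw [mul_comm (phiOne d P z - theta d P)]
      exact hz.mul_const _
  -- This is the remainder bound divided by `‖u n‖`, with `c = C * ‖u n‖₊`; it vanishes because the
  -- mechanism factor tends to `1`.
  have herr : Tendsto (fun n => (C : ℝ) * ((mechanismFactor (C * ‖u n‖₊) ^ 2) ^ τ - 1) * K)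
      atTop (𝓝 0) := by
    have h1 : Tendsto (fun n => mechanismFactor (C * ‖u n‖₊)) atTop (𝓝 1) := by
      have h0 : mechanismFactor 0 = 1 := by simp [mechanismFactor]
      rw [← h0]
      exact continuousAt_mechanismFactor_zero.tendsto.comp hc0
    have h2 := ((((h1.pow 2).pow τ).sub_const 1).const_mul (C : ℝ)).mul_const K
    simpa using h2
  have hdiff : Tendsto (fun n => (u n)⁻¹ * (theta d (Q (u n)) - theta d P) -
      ∫ z, ((u n)⁻¹ * ((r (u n) z : ℝ) - 1)) * (phiOne d P z - theta d P)
        ∂(P : Measure (LongData L A τ))) atTop (𝓝 0) := by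
    refine squeeze_zero_norm' ?_ herr
    filter_upwards [hu0.eventually hr, hune, hsmall] with n hn hn0 hn1
    obtain ⟨hrm, hQ, hb⟩ := hn
    have h := hK (Q (u n)) (r (u n)) _ hrm hn1 hQ hb
    have hrm' : AEStronglyMeasurable (fun z => (r (u n) z : ℝ) - 1)
        (P : Measure (LongData L A τ)) := (hrm.coe_nnreal_real.sub_const 1).aestronglyMeasurable
    have hri : Integrable (fun z => (r (u n) z : ℝ) - 1) (P : Measure (LongData L A τ)) := by
      simpa using (integrable_const (1 : ℝ)).bdd_mul hrm' hb
    -- Both laws have mass `1`, so `r - 1` has mean zero and the centring constant drops out of the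
    -- linear term.
    have hr1 : ∫ z, ((r (u n) z : ℝ) - 1) ∂(P : Measure (LongData L A τ)) = 0 := by
      have h1 : ∫ _, (1 : ℝ) ∂(Q (u n) : Measure (LongData L A τ)) = 1 := by simp
      rw [hQ, integral_withDensity_eq_integral_smul hrm] at h1
      simp only [NNReal.smul_def, smul_eq_mul, mul_one] at h1
      have hri' : Integrable (fun z => (r (u n) z : ℝ)) (P : Measure (LongData L A τ)) := by
        simpa [Pi.add_def] using hri.add (integrable_const (1 : ℝ))
      rw [integral_sub hri' (integrable_const _), h1]
      simp
    have h2 : ∫ z, ((u n)⁻¹ * ((r (u n) z : ℝ) - 1)) * (phiOne d P z - theta d P)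
        ∂(P : Measure (LongData L A τ)) =
        (u n)⁻¹ * ∫ z, ((r (u n) z : ℝ) - 1) * phiOne d P z
          ∂(P : Measure (LongData L A τ)) := by
      have h3 : ∀ z, ((u n)⁻¹ * ((r (u n) z : ℝ) - 1)) * (phiOne d P z - theta d P) =
          (u n)⁻¹ * (((r (u n) z : ℝ) - 1) * phiOne d P z - ((r (u n) z : ℝ) - 1) * theta d P) :=
        fun z => by ring
      simp only [h3]
      rw [integral_const_mul, integral_sub (hphi.bdd_mul hrm' hb) (hri.mul_const _),
        integral_mul_const, hr1, zero_mul, sub_zero]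
    rw [h2, ← mul_sub, norm_mul, norm_inv, inv_mul_le_iff₀ (norm_pos_iff.2 hn0)]
    refine h.trans (le_of_eq ?_)
    push_cast
    ring
  simpa [Function.comp_def] using hdiff.add hmain

end Derivative

end

theorem corollary1 {L A : ℕ → Type*} {τ : ℕ}
    [∀ t, TopologicalSpace (L t)] [∀ t, PolishSpace (L t)]
    [∀ t, MeasurableSpace (L t)] [∀ t, BorelSpace (L t)] [∀ t, Nonempty (L t)]
    [∀ t, TopologicalSpace (A t)] [∀ t, DiscreteTopology (A t)]
    [∀ t, MeasurableSpace (A t)] [∀ t, DiscreteMeasurableSpace (A t)]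
    [∀ t, Countable (A t)] [∀ t, Nonempty (A t)]
    (d : Policy L A)
    (hd : ∀ t, Measurable (fun x : Traj A (t + 1) × Hist L A t => d t x.1 x.2))
    (ν : Measure (LongData L A τ)) (P : ProbabilityMeasure (LongData L A τ))
    (hP : P ∈ nonparametricModel ν)
    (hpos : Positivity d P) (hfin : FiniteInterventionMean d P)
    (hvar : MemLp (phiOne d P) 2 (P : Measure (LongData L A τ))) :
    IsEfficientInfluenceFunction ν (theta d) P (fun z => phiOne d P z - theta d P) := by
  have hphi := integrable_and_integral_phiOne hd hpos hfin
  have hmem : MemLp (fun z => phiOne d P z - theta d P) 2 (P : Measure (LongData L A τ)) :=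
    hvar.sub (memLp_const _)
  refine ⟨hmem, fun Q s hs => hasDerivAt_theta hd hpos hfin hs, ?_⟩
  -- No direction of mean zero is excluded from the tangent space, so only the mean of the gradient
  -- remains to be computed.
  refine mem_tangentSpace_of_integral_eq_zero hP hmem ?_
  rw [integral_sub hphi.1 (integrable_const _), hphi.2]
  simp
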